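/- **Setting.** $M\ge 1$ agents repeatedly choose among $N$ arms at times $t=1,2,\dots$. They communicate over a connected undirected graph on $\{1,\dots,M\}$ with Laplacian $\mathcal L$ and maximal degree $d_{\max}$. Let $P=I-\frac{\kappa}{d_{\max}}\mathcal L$ with $\kappa\in(0,1]$ (and $P=1$ if $M=1$), let $\lambda_1\ge\lambda_2\ge\dots\ge\lambda_M$ be the eigenvalues of $P$, let $u_1,\dots,u_M$ be any corresponding orthonormal basis of eigenvectors, with entries $u_p^d$, and assume $\lambda_M>-1$ (so that $\lambda_1=1$ and $|\lambda_p|<1$ for $p\ge2$). Put $$\nu^{+}_{pj}=\sum_{d:\,u_p^du_j^d\ge0}u_p^du_j^d,\qquad \nu^{-}_{pj}=\sum_{d:\,u_p^du_j^d\le0}u_p^du_j^d,$$ and let $a_{pj}(k)$ be $\nu^+_{pj}u_p^ku_j^k$ if $\lambda_p\lambda_j\ge0$ and $u_p^ku_j^k\ge0$; $\nu^-_{pj}u_p^ku_j^k$ if $\lambda_p\lambda_j\ge0$ and $u_p^ku_j^k\le0$; and $\max\{|\nu^-_{pj}|,\nu^+_{pj}\}\,|u_p^ku_j^k|$ if $\lambda_p\lambda_j<0$.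 The explore-exploit indices are $$\epsilon_n=\sqrt M\sum_{p=2}^M\frac{|\lambda_p|}{1-|\lambda_p|},\qquad \epsilon_c^k=M\sum_{p=1}^M\sum_{j=2}^M\frac{|\lambda_p\lambda_j|}{1-|\lambda_p\lambda_j|}\,a_{pj}(k).$$ *Rewards.* Arm $i$ has a reward law $p_i$ on $\mathbb R$ with mean $m_i$ which is sub-Gaussian with a common parameter $\sigma_g>0$: $\ln\int e^{\beta x}\,dp_i(x)\le m_i\beta+\sigma_g^2\beta^2/2<\infty$ for all $\beta\in\mathbb R$. The reward $r_i^k(t)$ of agent $k$ at arm $i$ and time $t$ has law $p_i$, and the reward vectors $(r_i^k(t))_{i\le N}$ are independent over distinct pairs $(k,t)$. An agent that selects arm $i$ at time $t$ receives $r_i^k(t)$ whatever the others do (unconstrained reward model). Let $\Delta_i=\max_j m_j-m_i$; arm $i$ is suboptimal if $\Delta_i>0$. *Algorithm coop-UCB2.* Let $\gamma>1$, $\eta\in(0,4)$, $G(\eta)=1-\eta^2/16$, and let $f:[t_0,\infty)\to\mathbb R$, where $t_0\in[0,1]$, be nondecreasing and sublogarithmic, i.e. $f(t)/\ln t\to0$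 as $t\to\infty$. Write $i^k(t)$ for the arm selected by agent $k$ at time $t$. For each arm $i$, vectors $\hat n_i(t),\hat s_i(t)\in\mathbb R^M$ with entries $\hat n_i^k(t)$, $\hat s_i^k(t)$ are given by $\hat n_i(0)=\hat s_i(0)=0$ and $$\hat n_i(t)=P\big(\hat n_i(t-1)+\xi_i(t)\big),\qquad \hat s_i(t)=P\big(\hat s_i(t-1)+r_i(t)\big),$$ where $\xi_i(t)$ and $r_i(t)$ have entries $\mathbf 1\{i^k(t)=i\}$ and $r_i^k(t)\mathbf 1\{i^k(t)=i\}$, $k=1,\dots,M$. At times $t=1,\dots,N$ every agent selects arm $t$; at each time $t>N$ agent $k$ selects an arm maximizing $Q_i^k(t-1)$ over $i$, where $$Q_i^k(t)=\frac{\hat s_i^k(t)}{\hat n_i^k(t)}+\sigma_g\sqrt{\frac{2\gamma}{G(\eta)}\cdot\frac{\hat n_i^k(t)+f(t)}{M\,\hat n_i^k(t)}\cdot\frac{\ln t}{\hat n_i^k(t)}},$$ with ties broken in any way that depends measurably only on rewards at earlier times. (Square roots of negative numbers are read as $0$; they do not occur if $f\ge0$.) Let $n_i^k(T)$ be the number of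 times $t\le T$ at which agent $k$ selects arm $i$. **Theorem.** Assume that for every $k$ some $t\ge t_0$ satisfies $f(t)\ge\epsilon_c^k$, and let $t_k^\dagger=\inf\{t\ge t_0: f(t)\ge\epsilon_c^k\}$, which is $f^{-1}(\epsilon_c^k)$ if $f$ is strictly increasing and takes the value $\epsilon_c^k$. Then for every suboptimal arm $i$ and every integer $T\ge1$, $$\sum_{k=1}^M\mathbb E[n_i^k(T)]\le\frac{4\sigma_g^2\gamma\ln T}{\Delta_i^2G(\eta)}\left(1+\sqrt{1+\frac{\Delta_i^2MG(\eta)}{2\gamma\sigma_g^2}\,\frac{f(T)}{\ln T}}\right)+L$$ (for $T=1$ the first term on the right is read as $0$), where $$L=L(\epsilon_n,\epsilon_c^1,\dots,\epsilon_c^M)=\sum_{k=1}^M(t_k^\dagger-1)+M(1+\epsilon_n)+1+\frac{2M}{\ln(1+\eta)}\left(\frac1{(\gamma-1)^2}+\frac{\gamma\ln\big((1+\epsilon_n)(1+\eta)\big)}{\gamma-1}+1\right)$$ does not depend on $T$, and depends on the graph only through $\epsilon_n$ and $\epsilon_c^1,\dots,\epsilon_c^M$. -/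

import Mathlib

open MeasureTheory ProbabilityTheory
open scoped Matrix

namespace CoopUCB

noncomputable section

/-! Communication graph, consensus matrix and explore-exploit indices.
Agents are `Fin M`; the agent/eigenvalue with index `0` is the first one. -/

/-- The consensus matrix `P = I - (κ / d_max) L`, with `L` the Laplacian of the graph. -/
def consensusMatrix {M : ℕ} (G : SimpleGraph (Fin M)) [DecidableRel G.Adj] (κ : ℝ) :
    Matrix (Fin M) (Fin M) ℝ :=
  1 - (κ / (G.maxDegree : ℝ)) • G.lapMatrix ℝ

/-- `lam` lists the eigenvalues of `P` in decreasing order and `u` is a corresponding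
orthonormal basis of eigenvectors. -/
structure IsOrderedEigenbasis {M : ℕ} (P : Matrix (Fin M) (Fin M) ℝ)
    (u : OrthonormalBasis (Fin M) ℝ (EuclideanSpace ℝ (Fin M))) (lam : Fin M → ℝ) : Prop where
  eigen : ∀ p, P *ᵥ (fun d => u p d) = fun d => lam p * u p d
  ordered : Antitone lam

/-- `ν⁺_{pj}`: the sum of the nonnegative products `u_p^d u_j^d`. -/
def nuPlus {M : ℕ} (u : OrthonormalBasis (Fin M) ℝ (EuclideanSpace ℝ (Fin M)))
    (p j : Fin M) : ℝ :=
  ∑ d, if 0 ≤ u p d * u j d then u p d * u j d else 0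

/-- `ν⁻_{pj}`: the sum of the nonpositive products `u_p^d u_j^d`. -/
def nuMinus {M : ℕ} (u : OrthonormalBasis (Fin M) ℝ (EuclideanSpace ℝ (Fin M)))
    (p j : Fin M) : ℝ :=
  ∑ d, if u p d * u j d ≤ 0 then u p d * u j d else 0

/-- The coefficient `a_{pj}(k)`. -/
def aCoeff {M : ℕ} (u : OrthonormalBasis (Fin M) ℝ (EuclideanSpace ℝ (Fin M)))
    (lam : Fin M → ℝ) (p j k : Fin M) : ℝ :=
  if 0 ≤ lam p * lam j then
    if 0 ≤ u p k * u j k then nuPlus u p j * (u p k * u j k)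
    else nuMinus u p j * (u p k * u j k)
  else max |nuMinus u p j| (nuPlus u p j) * |u p k * u j k|

/-- The graph explore-exploit index `ε_n`. -/
def epsN {M : ℕ} [NeZero M] (lam : Fin M → ℝ) : ℝ :=
  Real.sqrt M * ∑ p ∈ Finset.univ.erase (0 : Fin M), |lam p| / (1 - |lam p|)

/-- The nodal explore-exploit centrality index `ε_c^k`. -/
def epsC {M : ℕ} [NeZero M] (u : OrthonormalBasis (Fin M) ℝ (EuclideanSpace ℝ (Fin M)))
    (lam : Fin M → ℝ) (k : Fin M) : ℝ :=
  M * ∑ p, ∑ j ∈ Finset.univ.erase (0 : Fin M),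
    |lam p * lam j| / (1 - |lam p * lam j|) * aCoeff u lam p j k

/-! Rewards. `r t k i ω` is the reward realized at arm `i` for agent `k` at time `t`;
times are `1, 2, 3, …` (the value at `t = 0` is never used). -/

/-- The mean of a law on `ℝ`. -/
def mean (p : Measure ℝ) : ℝ := ∫ x, x ∂p

/-- Sub-Gaussian law with parameter `σ`: the cumulant generating function is finite everywhere
and bounded by `m β + σ² β² / 2`. -/
structure IsSubGaussian (p : Measure ℝ) (σ : ℝ) : Prop where
  integrable_id : Integrable (fun x : ℝ => x) p
  integrable_exp : ∀ β : ℝ, Integrable (fun x : ℝ => Real.exp (β * x)) p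
  cgf_le : ∀ β : ℝ, cgf (fun x : ℝ => x) p β ≤ mean p * β + σ ^ 2 * β ^ 2 / 2

/-- The rewards at arm `i` have law `p i`, and the reward vectors `(r t k i)_i` are independent
over distinct pairs (time, agent). Nothing is assumed on the dependence between different arms
for one agent at one time. -/
structure IsRewardProcess {Ω : Type*} [MeasurableSpace Ω] (μ : Measure Ω) {M N : ℕ}
    (p : Fin N → Measure ℝ) (r : ℕ → Fin M → Fin N → Ω → ℝ) : Prop where
  measurable : ∀ t k i, Measurable (r t k i)
  law : ∀ t k i, μ.map (r t k i) = p i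
  indep : iIndepFun (fun (s : ℕ × Fin M) (ω : Ω) (i : Fin N) => r s.1 s.2 i ω) μ

/-- The sigma-algebra generated by all rewards at times `1, …, t - 1`. -/
def pastRewards {Ω : Type*} {M N : ℕ} (r : ℕ → Fin M → Fin N → Ω → ℝ) (t : ℕ) :
    MeasurableSpace Ω :=
  ⨆ (τ : ℕ) (_ : 1 ≤ τ ∧ τ < t) (k : Fin M) (i : Fin N),
    MeasurableSpace.comap (r τ k i) inferInstance

/-! Cooperative estimation along one realization: `a t k` is the arm selected by agent `k` at time
`t`, `x t k i` is the reward at arm `i` for agent `k` at time `t`. -/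

/-- The vector of estimates `n̂_i(t) = P (n̂_i(t-1) + ξ_i(t))`, `n̂_i(0) = 0`. -/
def nHat {M N : ℕ} (P : Matrix (Fin M) (Fin M) ℝ) (a : ℕ → Fin M → Fin N) (i : Fin N) :
    ℕ → Fin M → ℝ
  | 0 => 0
  | t + 1 => P *ᵥ (nHat P a i t + fun k => if a (t + 1) k = i then 1 else 0)

/-- The vector of estimates `ŝ_i(t) = P (ŝ_i(t-1) + r_i(t))`, `ŝ_i(0) = 0`, where `r_i(t)` holds
the rewards collected at arm `i` at time `t`. -/
def sHat {M N : ℕ} (P : Matrix (Fin M) (Fin M) ℝ) (x : ℕ → Fin M → Fin N → ℝ)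
    (a : ℕ → Fin M → Fin N) (i : Fin N) : ℕ → Fin M → ℝ
  | 0 => 0
  | t + 1 => P *ᵥ (sHat P x a i t + fun k => if a (t + 1) k = i then x (t + 1) k i else 0)

/-- `G(η) = 1 - η² / 16`. -/
def gEta (η : ℝ) : ℝ := 1 - η ^ 2 / 16

/-- The index `Q_i^k(t) = μ̂_i^k(t) + C_i^k(t)`. -/
def qIndex {M N : ℕ} (P : Matrix (Fin M) (Fin M) ℝ) (σ γ η : ℝ) (f : ℝ → ℝ)
    (x : ℕ → Fin M → Fin N → ℝ) (a : ℕ → Fin M → Fin N) (t : ℕ) (k : Fin M) (i : Fin N) : ℝ :=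
  sHat P x a i t k / nHat P a i t k +
    σ * Real.sqrt (2 * γ / gEta η * ((nHat P a i t k + f t) / (M * nHat P a i t k)) *
      (Real.log t / nHat P a i t k))

/-- The random arm selections `a` are produced by coop-UCB2: at the times `1, …, N` every agent
samples the arms one after the other, and at every time `t + 1 > N` every agent selects an arm that
maximizes its index at time `t`. Ties may be broken by any rule that depends only on past
rewards. -/
structure IsCoopUCB2 {Ω : Type*} {M N : ℕ} (P : Matrix (Fin M) (Fin M) ℝ) (σ γ η : ℝ)
    (f : ℝ → ℝ) (r : ℕ → Fin M → Fin N → Ω → ℝ) (a : ℕ → Fin M → Ω → Fin N) : Prop where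
  init : ∀ t k ω, 1 ≤ t → t ≤ N → (a t k ω : ℕ) + 1 = t
  predictable : ∀ t k, 1 ≤ t → Measurable[pastRewards r t] (a t k)
  argmax : ∀ t k ω, N ≤ t → ∀ i,
    qIndex P σ γ η f (fun s l j => r s l j ω) (fun s l => a s l ω) t k i ≤
      qIndex P σ γ η f (fun s l j => r s l j ω) (fun s l => a s l ω) t k (a (t + 1) k ω)

/-- `n_i^k(T)`: how often agent `k` selects arm `i` at the times `1, …, T`. -/
def numSelections {Ω : Type*} {M N : ℕ} (a : ℕ → Fin M → Ω → Fin N) (i : Fin N) (k : Fin M)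
    (T : ℕ) (ω : Ω) : ℕ :=
  ((Finset.Icc 1 T).filter fun t => a t k ω = i).card

/-! The bound. -/

/-- `Δ_i`: the largest mean reward minus the mean reward of arm `i`. -/
def gap {N : ℕ} (p : Fin N → Measure ℝ) (i : Fin N) : ℝ := (⨆ j, mean (p j)) - mean (p i)

/-- `t† = f⁻¹(e)` for a nondecreasing `f` on `[t₀, ∞)`: the first time from which on `f ≥ e`. -/
def tDagger (t₀ : ℝ) (f : ℝ → ℝ) (e : ℝ) : ℝ := sInf {t : ℝ | t₀ ≤ t ∧ e ≤ f t}

/-- For strictly increasing `f`, `tDagger` is the inverse function of `f`. -/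
theorem tDagger_apply {t₀ : ℝ} {f : ℝ → ℝ} (hf : StrictMonoOn f (Set.Ici t₀)) {t : ℝ}
    (ht : t₀ ≤ t) : tDagger t₀ f (f t) = t := by
  have h : {s : ℝ | t₀ ≤ s ∧ f t ≤ f s} = Set.Ici t := by
    ext s
    constructor
    · rintro ⟨h1, h2⟩
      exact (hf.le_iff_le ht h1).1 h2
    · intro h1
      have h2 : t₀ ≤ s := le_trans ht h1
      exact ⟨h2, (hf.le_iff_le ht h2).2 h1⟩
  rw [tDagger, h, csInf_Ici]

/-- The constant `L(ε_n, ε_c^1, …, ε_c^M)`. -/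
def constL (M : ℕ) (γ η t₀ : ℝ) (f : ℝ → ℝ) (εn : ℝ) (εc : Fin M → ℝ) : ℝ :=
  ∑ k, (tDagger t₀ f (εc k) - 1) + M * (1 + εn) + 1 +
    2 * M / Real.log (1 + η) *
      (1 / (γ - 1) ^ 2 + γ * Real.log ((1 + εn) * (1 + η)) / (γ - 1) + 1)

end

end CoopUCB

/-! Fix a suboptimal arm `i` and a best arm `b`, and follow the number of selections of `i` summed
over all agents. The spectral expansion of the powers of `P` shows that each agent's estimate `nHat`
stays within `epsN` of the network average (`abs_consensus_sub_average_le`). Hence, once the total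
exceeds a threshold of order `Real.log T` by `M * epsN`, every agent's confidence radius at `i` is
at most half the gap (`two_mul_radius_le`). From then on, selecting `i` forces a deviation larger
than the radius: `i` is overestimated or `b` is underestimated (`one_le_deviationSum`).

The deviation is a weighted sum of centred rewards, with weights the entries of `P ^ (t - s)`. Its
variance proxy `energy` is at most `(nHat + epsC) / M` (`sum_sq_consensus_le`), so the radius is
calibrated as soon as `f t` reaches `epsC`; the earlier rounds are counted by `tDagger`. Since
`nHat` is random, its range is peeled into geometric cells of ratio `1 + η`, each with its own
exponential tilt. The indicator of a deviation is then at most `t ^ (-γ)` times a sum over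
`cellCount η t` cells of exponentials (`one_le_sum_exp_tilt`), each of mean at most `1`
(`IsRewardProcess.integral_expProcess_le`).

The pathwise bound `sum_selections_le` combines these facts. Integrating it leaves a series of terms
`t ^ (-γ)` and `Real.log t * t ^ (-γ)`, whose sum is absorbed by `constL`. -/

namespace CoopUCB

/-! ### Orthonormality and completeness in coordinates -/

section Basis

variable {M : ℕ} (u : OrthonormalBasis (Fin M) ℝ (EuclideanSpace ℝ (Fin M)))

theorem basis_sum_mul (p j : Fin M) : ∑ d, u p d * u j d = if p = j then 1 else 0 := by
  have h := orthonormal_iff_ite.1 u.orthonormal p j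
  rw [← h, EuclideanSpace.inner_eq_star_dotProduct]
  simp [dotProduct, mul_comm]

theorem basis_completeness (k d : Fin M) : ∑ p, u p k * u p d = if k = d then 1 else 0 := by
  have h := u.sum_inner_mul_inner (EuclideanSpace.single k (1 : ℝ)) (EuclideanSpace.single d 1)
  simpa [EuclideanSpace.inner_single_left, EuclideanSpace.inner_single_right,
    eq_comm, Pi.single_apply] using h

theorem basis_abs_le_one (p k : Fin M) : |u p k| ≤ 1 := by
  have h := basis_completeness u k k
  have h1 : u p k * u p k ≤ ∑ p, u p k * u p k :=
    Finset.single_le_sum (f := fun p => u p k * u p k)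
      (fun q _ => mul_self_nonneg (u q k)) (Finset.mem_univ p)
  rw [h, if_pos rfl] at h1
  exact abs_le_one_iff_mul_self_le_one.2 h1

end Basis

/-! ### The consensus matrix is symmetric and stochastic -/

section Stochastic

variable {M : ℕ} (G : SimpleGraph (Fin M)) [DecidableRel G.Adj] (κ : ℝ)

theorem consensusMatrix_mulVec (x : Fin M → ℝ) :
    consensusMatrix G κ *ᵥ x = x - (κ / (G.maxDegree : ℝ)) • (G.lapMatrix ℝ *ᵥ x) := by
  rw [consensusMatrix, Matrix.sub_mulVec, Matrix.one_mulVec, Matrix.smul_mulVec]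

theorem consensusMatrix_mulVec_one : consensusMatrix G κ *ᵥ (fun _ => 1) = fun _ => 1 := by
  rw [consensusMatrix_mulVec, G.lapMatrix_mulVec_const_eq_zero, smul_zero, sub_zero]

theorem consensusMatrix_isSymm : (consensusMatrix G κ).IsSymm := by
  have h : (G.lapMatrix ℝ)ᵀ = G.lapMatrix ℝ := G.isSymm_lapMatrix ℝ
  simp [consensusMatrix, Matrix.IsSymm, Matrix.transpose_sub, Matrix.transpose_smul, h]

/-- Diagonal entries are `1 - κ * degree / maxDegree`, with degree at most `maxDegree` and `κ ≤ 1`.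
For an edgeless graph, division by zero makes the coefficient `0` and the matrix the identity. -/
theorem consensusMatrix_nonneg {κ : ℝ} (hκ0 : 0 < κ) (hκ1 : κ ≤ 1) (k d : Fin M) :
    0 ≤ consensusMatrix G κ k d := by
  have hc : 0 ≤ κ / (G.maxDegree : ℝ) := by positivity
  by_cases h : k = d
  · subst h
    have h1 : G.lapMatrix ℝ k k = G.degree k := by
      simp [SimpleGraph.lapMatrix, SimpleGraph.degMatrix]
    have h2 : κ / (G.maxDegree : ℝ) * G.degree k ≤ 1 := by
      have h3 : (G.degree k : ℝ) ≤ G.maxDegree := by exact_mod_cast G.degree_le_maxDegree k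
      calc κ / (G.maxDegree : ℝ) * G.degree k ≤ κ / (G.maxDegree : ℝ) * G.maxDegree := by gcongr
        _ ≤ κ := by
          rcases eq_or_ne (G.maxDegree : ℝ) 0 with h0 | h0
          · simp [h0, hκ0.le]
          · rw [div_mul_cancel₀ _ h0]
        _ ≤ 1 := hκ1
    simp [consensusMatrix, h1, h2]
  · have h1 : G.lapMatrix ℝ k d = - (if G.Adj k d then 1 else 0) := by
      simp [SimpleGraph.lapMatrix, SimpleGraph.degMatrix, h, SimpleGraph.adjMatrix_apply]
    have h2 : consensusMatrix G κ k d =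
        κ / (G.maxDegree : ℝ) * (if G.Adj k d then 1 else 0) := by
      simp only [consensusMatrix, Matrix.sub_apply, Matrix.one_apply_ne h, Matrix.smul_apply, h1,
        smul_eq_mul]
      ring
    rw [h2]
    split_ifs <;> simp [hc]

end Stochastic

/-! ### Powers of a stochastic matrix and closed forms of the estimates -/

section Powers

variable {M : ℕ} {P : Matrix (Fin M) (Fin M) ℝ}

theorem pow_mulVec_one (h : P *ᵥ (fun _ => 1) = fun _ => 1) (s : ℕ) :
    (P ^ s) *ᵥ (fun _ => 1) = fun _ => 1 := by
  induction s with
  | zero => simp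
  | succ s ih => rw [pow_succ, ← Matrix.mulVec_mulVec, h, ih]

theorem pow_row_sum (h : P *ᵥ (fun _ => 1) = fun _ => 1) (s : ℕ) (k : Fin M) :
    ∑ d, (P ^ s) k d = 1 := by
  simpa [Matrix.mulVec, dotProduct] using congrFun (pow_mulVec_one h s) k

theorem pow_entry_nonneg (h : ∀ k d, 0 ≤ P k d) (s : ℕ) (k d : Fin M) : 0 ≤ (P ^ s) k d := by
  induction s generalizing d with
  | zero => simp only [pow_zero, Matrix.one_apply]; split_ifs <;> simp
  | succ s ih =>
    rw [pow_succ, Matrix.mul_apply]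
    exact Finset.sum_nonneg fun j _ => mul_nonneg (ih j) (h j d)

/-- The closed form of the consensus recursion `y (t + 1) = P (y t + z (t + 1))`, `y 0 = 0`. -/
theorem consensus_closed_form {y z : ℕ → Fin M → ℝ} (h0 : y 0 = 0)
    (hs : ∀ t, y (t + 1) = P *ᵥ (y t + z (t + 1))) (t : ℕ) (k : Fin M) :
    y t k = ∑ s ∈ Finset.range t, ∑ d, (P ^ (t - s)) k d * z (s + 1) d := by
  suffices h : y t = ∑ s ∈ Finset.range t, (P ^ (t - s)) *ᵥ z (s + 1) by
    rw [h, Finset.sum_apply]; rfl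
  induction t with
  | zero => simp [h0]
  | succ t ih =>
    rw [hs, Finset.sum_range_succ, Matrix.mulVec_add, ih, Matrix.mulVec_sum]
    congr 1
    · refine Finset.sum_congr rfl fun s hs => ?_
      have : t + 1 - s = (t - s) + 1 := by have := Finset.mem_range.1 hs; omega
      rw [this, pow_succ', Matrix.mulVec_mulVec]
    · simp

theorem nHat_eq {N : ℕ} (a : ℕ → Fin M → Fin N) (i : Fin N) (t : ℕ) (k : Fin M) :
    nHat P a i t k = ∑ s ∈ Finset.range t, ∑ d,
      (P ^ (t - s)) k d * (if a (s + 1) d = i then 1 else 0) :=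
  consensus_closed_form (z := fun s d => if a s d = i then 1 else 0) rfl (fun _ => rfl) t k

theorem sHat_eq {N : ℕ} (x : ℕ → Fin M → Fin N → ℝ) (a : ℕ → Fin M → Fin N) (i : Fin N) (t : ℕ)
    (k : Fin M) :
    sHat P x a i t k = ∑ s ∈ Finset.range t, ∑ d,
      (P ^ (t - s)) k d * (if a (s + 1) d = i then x (s + 1) d i else 0) :=
  consensus_closed_form (z := fun s d => if a s d = i then x s d i else 0) rfl (fun _ => rfl) t k

theorem nHat_le {N : ℕ} (h0 : ∀ k d, 0 ≤ P k d) (h1 : P *ᵥ (fun _ => 1) = fun _ => 1)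
    (a : ℕ → Fin M → Fin N) (i : Fin N) (t : ℕ) (k : Fin M) : nHat P a i t k ≤ t := by
  rw [nHat_eq]
  calc _ ≤ ∑ s ∈ Finset.range t, ∑ d, (P ^ (t - s)) k d := by
        refine Finset.sum_le_sum fun s _ => Finset.sum_le_sum fun d _ => ?_
        refine mul_le_of_le_one_right (pow_entry_nonneg h0 _ _ _) ?_
        split_ifs <;> simp
    _ = t := by simp [pow_row_sum h1]

/-- A round in which all agents select `i` contributes a full row sum of a power of `P`, which is
`1` at every later time. -/
theorem one_le_nHat {N : ℕ} (h0 : ∀ k d, 0 ≤ P k d) (h1 : P *ᵥ (fun _ => 1) = fun _ => 1)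
    (a : ℕ → Fin M → Fin N) (i : Fin N) {t s : ℕ} (hs : s < t) (ha : ∀ d, a (s + 1) d = i)
    (k : Fin M) : 1 ≤ nHat P a i t k := by
  rw [nHat_eq]
  calc (1 : ℝ) = ∑ d, (P ^ (t - s)) k d * (if a (s + 1) d = i then 1 else 0) := by
        simp [ha, pow_row_sum h1]
    _ ≤ _ := by
        refine Finset.single_le_sum (f := fun s => ∑ d, (P ^ (t - s)) k d *
          (if a (s + 1) d = i then (1 : ℝ) else 0)) (fun s _ => ?_) (Finset.mem_range.2 hs)
        refine Finset.sum_nonneg fun d _ => mul_nonneg (pow_entry_nonneg h0 _ _ _) ?_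
        split_ifs <;> simp

end Powers

/-! ### Spectrum of the consensus matrix of a connected graph -/

section Spectral

variable {M : ℕ} {u : OrthonormalBasis (Fin M) ℝ (EuclideanSpace ℝ (Fin M))} {lam : Fin M → ℝ}

namespace IsOrderedEigenbasis

theorem pow_mulVec {P : Matrix (Fin M) (Fin M) ℝ} (hu : IsOrderedEigenbasis P u lam) (s : ℕ)
    (p : Fin M) : (P ^ s) *ᵥ (fun d => u p d) = fun d => lam p ^ s * u p d := by
  induction s with
  | zero => simp
  | succ s ih =>
    rw [pow_succ', ← Matrix.mulVec_mulVec, ih]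
    have : (fun d => lam p ^ s * u p d) = lam p ^ s • fun d => u p d := rfl
    rw [this, Matrix.mulVec_smul, hu.eigen]
    ext d
    simp [pow_succ, mul_assoc]

theorem pow_apply {P : Matrix (Fin M) (Fin M) ℝ} (hu : IsOrderedEigenbasis P u lam) (s : ℕ)
    (k d : Fin M) : (P ^ s) k d = ∑ p, lam p ^ s * (u p k * u p d) := by
  calc (P ^ s) k d = ∑ j, (P ^ s) k j * ∑ p, u p j * u p d := by simp [basis_completeness]
    _ = ∑ p, (∑ j, (P ^ s) k j * u p j) * u p d := by
        simp_rw [Finset.mul_sum, Finset.sum_mul]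
        rw [Finset.sum_comm]
        simp_rw [mul_assoc]
    _ = _ := by
        refine Finset.sum_congr rfl fun p _ => ?_
        have := congrFun (hu.pow_mulVec s p) k
        simp only [Matrix.mulVec, dotProduct] at this
        rw [this]; ring

variable {G : SimpleGraph (Fin M)} [DecidableRel G.Adj] {κ : ℝ}

theorem smul_lapMatrix_mulVec (hu : IsOrderedEigenbasis (consensusMatrix G κ) u lam) (p : Fin M) :
    (κ / (G.maxDegree : ℝ)) • (G.lapMatrix ℝ *ᵥ fun d => u p d) =
      (1 - lam p) • fun d => u p d := by
  have h := hu.eigen p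
  rw [consensusMatrix_mulVec] at h
  ext d
  have := congrFun h d
  simp only [Pi.sub_apply, Pi.smul_apply, smul_eq_mul] at this ⊢
  linarith

theorem lam_le_one (hu : IsOrderedEigenbasis (consensusMatrix G κ) u lam) (hκ0 : 0 < κ)
    (p : Fin M) : lam p ≤ 1 := by
  have h := congrArg (fun v => (fun d => u p d) ⬝ᵥ v) (hu.smul_lapMatrix_mulVec p)
  simp only [dotProduct_smul, smul_eq_mul] at h
  have h1 : (fun d => u p d) ⬝ᵥ (fun d => u p d) = 1 := by
    simpa [dotProduct] using basis_sum_mul u p p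
  have h2 := (G.posSemidef_lapMatrix ℝ).dotProduct_mulVec_nonneg (fun d => u p d)
  rw [star_trivial] at h2
  have h3 : 0 ≤ κ / (G.maxDegree : ℝ) := by positivity
  have := mul_nonneg h3 h2
  rw [h, h1] at this
  linarith

/-- An eigenvector for the eigenvalue `1` lies in the kernel of the Laplacian, which consists of
constants on a connected graph. If the scalar `κ / maxDegree` vanishes there are no edges, and the
edgewise criterion is vacuous. -/
theorem eq_of_lam_eq_one (hu : IsOrderedEigenbasis (consensusMatrix G κ) u lam)
    (hG : G.Connected) (hκ0 : 0 < κ) {p : Fin M} (hp : lam p = 1) (k d : Fin M) :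
    u p k = u p d := by
  have h := hu.smul_lapMatrix_mulVec p
  rw [hp, sub_self, zero_smul, smul_eq_zero] at h
  have hL : G.lapMatrix ℝ *ᵥ (fun d => u p d) = 0 := by
    refine G.lapMatrix_mulVec_eq_zero_iff_forall_adj.2 fun i j hij => ?_
    have hdeg : 0 < G.maxDegree :=
      ((G.degree_pos_iff_exists_adj i).2 ⟨j, hij⟩).trans_le (G.degree_le_maxDegree i)
    rcases h with h | h
    · have : 0 < κ / (G.maxDegree : ℝ) := by positivity
      exact absurd h this.ne'
    · exact G.lapMatrix_mulVec_eq_zero_iff_forall_adj.1 h i j hij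
  exact G.lapMatrix_mulVec_eq_zero_iff_forall_reachable.1 hL k d (hG.preconnected k d)

variable [NeZero M]

/-- If no eigenvalue were `1`, symmetry would make every eigenvector orthogonal to the constant
vector, contradicting completeness. The ordering then places the eigenvalue `1` at index `0`. -/
theorem lam_zero (hu : IsOrderedEigenbasis (consensusMatrix G κ) u lam) (hκ0 : 0 < κ) :
    lam 0 = 1 := by
  refine le_antisymm (hu.lam_le_one hκ0 0) ?_
  obtain ⟨p, hp⟩ : ∃ p, lam p = 1 := by
    by_contra! hne
    have h0 : ∀ p, ∑ d, u p d = 0 := by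
      intro p
      have h1 : (fun _ => 1) ⬝ᵥ (consensusMatrix G κ *ᵥ fun d => u p d) = ∑ d, u p d := by
        rw [Matrix.dotProduct_mulVec, ← Matrix.mulVec_transpose, consensusMatrix_isSymm,
          consensusMatrix_mulVec_one]
        simp [dotProduct]
      rw [hu.eigen] at h1
      simp only [dotProduct, one_mul, ← Finset.mul_sum] at h1
      have h2 : (lam p - 1) * ∑ d, u p d = 0 := by linarith
      exact (mul_eq_zero.1 h2).resolve_left (sub_ne_zero.2 (hne p))
    have h1 : ∑ k, ∑ p, u p k * u p (0 : Fin M) = 1 := by simp [basis_completeness]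
    rw [Finset.sum_comm] at h1
    simp [← Finset.sum_mul, h0] at h1
  rw [← hp]
  exact hu.ordered (Fin.zero_le p)

theorem u_zero_mul (hu : IsOrderedEigenbasis (consensusMatrix G κ) u lam)
    (hG : G.Connected) (hκ0 : 0 < κ) (k d : Fin M) : u 0 k * u 0 d = 1 / M := by
  have hc := hu.eq_of_lam_eq_one hG hκ0 (hu.lam_zero hκ0)
  have h := basis_sum_mul u 0 0
  rw [Finset.sum_congr rfl fun j _ => by rw [hc j k]] at h
  simp only [Finset.sum_const, Finset.card_univ, Fintype.card_fin, nsmul_eq_mul, if_true] at h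
  have hM : (M : ℝ) ≠ 0 := NeZero.ne _
  rw [← hc k d]
  field_simp
  linarith

/-- A second eigenvalue `1` would give another constant eigenvector, and two nonzero constant
vectors are not orthogonal. -/
theorem abs_lam_lt_one (hu : IsOrderedEigenbasis (consensusMatrix G κ) u lam)
    (hG : G.Connected) (hκ0 : 0 < κ) (hlam : ∀ k, -1 < lam k) {p : Fin M} (hp : p ≠ 0) :
    |lam p| < 1 := by
  refine abs_lt.2 ⟨hlam p, lt_of_le_of_ne (hu.lam_le_one hκ0 p) fun h => ?_⟩
  have hc := hu.eq_of_lam_eq_one hG hκ0 h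
  have hc0 := hu.eq_of_lam_eq_one hG hκ0 (hu.lam_zero hκ0)
  have h1 := basis_sum_mul u p 0
  have h2 := basis_sum_mul u p p
  have h3 := basis_sum_mul u 0 0
  simp only [hc _ (0 : Fin M), hc0 _ (0 : Fin M), Finset.sum_const, Finset.card_univ,
    Fintype.card_fin, nsmul_eq_mul, hp, if_true, if_false, mul_eq_zero] at h1 h2 h3
  rcases h1 with h1 | h1 | h1
  · simp [h1] at h2
  · simp [h1] at h2
  · simp [h1] at h3

theorem abs_lam_mul_lt_one (hu : IsOrderedEigenbasis (consensusMatrix G κ) u lam)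
    (hG : G.Connected) (hκ0 : 0 < κ) (hlam : ∀ k, -1 < lam k) (p : Fin M) {j : Fin M}
    (hj : j ≠ 0) : |lam p * lam j| < 1 := by
  rw [abs_mul]
  have h1 : |lam p| ≤ 1 := abs_le.2 ⟨(hlam p).le, hu.lam_le_one hκ0 p⟩
  exact (mul_le_of_le_one_left (abs_nonneg _) h1).trans_lt (hu.abs_lam_lt_one hG hκ0 hlam hj)

end IsOrderedEigenbasis

end Spectral

/-! ### Consensus errors controlled by the two explore-exploit indices -/

section Indices

variable {M : ℕ} {u : OrthonormalBasis (Fin M) ℝ (EuclideanSpace ℝ (Fin M))} {lam : Fin M → ℝ}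

theorem geom_sum_le {q : ℝ} (hq0 : 0 ≤ q) (hq1 : q < 1) (t : ℕ) :
    ∑ s ∈ Finset.range t, q ^ (t - s) ≤ q / (1 - q) := by
  have h1 : 0 < 1 - q := by linarith
  induction t with
  | zero => simp only [Finset.range_zero, Finset.sum_empty]; positivity
  | succ t ih =>
    have h : ∑ s ∈ Finset.range (t + 1), q ^ (t + 1 - s) =
        q * ((∑ s ∈ Finset.range t, q ^ (t - s)) + 1) := by
      rw [Finset.sum_range_succ, mul_add, Finset.mul_sum]
      congr 1
      · refine Finset.sum_congr rfl fun s hs => ?_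
        have : t + 1 - s = (t - s) + 1 := by have := Finset.mem_range.1 hs; omega
        rw [this, pow_succ']
      · simp
    rw [h]
    calc q * ((∑ s ∈ Finset.range t, q ^ (t - s)) + 1) ≤ q * (q / (1 - q) + 1) := by gcongr
      _ = q / (1 - q) := by field_simp; ring

theorem nuPlus_nonneg (p j : Fin M) : 0 ≤ nuPlus u p j :=
  Finset.sum_nonneg fun d _ => by split_ifs with h <;> simp [h]

theorem nuMinus_nonpos (p j : Fin M) : nuMinus u p j ≤ 0 :=
  Finset.sum_nonpos fun d _ => by split_ifs with h <;> simp [h]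

/-- A linear form on the cube `[0, 1]^M` is largest when exactly the nonnegative coefficients are
switched on; `nuMinus` is the matching minimum. -/
theorem sum_mul_le_nuPlus {ξ : Fin M → ℝ} (h0 : ∀ d, 0 ≤ ξ d) (h1 : ∀ d, ξ d ≤ 1) (p j : Fin M) :
    ∑ d, u p d * u j d * ξ d ≤ nuPlus u p j := by
  refine Finset.sum_le_sum fun d _ => ?_
  split_ifs with h
  · exact mul_le_of_le_one_right h (h1 d)
  · exact mul_nonpos_of_nonpos_of_nonneg (not_le.1 h).le (h0 d)

theorem nuMinus_le_sum_mul {ξ : Fin M → ℝ} (h0 : ∀ d, 0 ≤ ξ d) (h1 : ∀ d, ξ d ≤ 1) (p j : Fin M) :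
    nuMinus u p j ≤ ∑ d, u p d * u j d * ξ d := by
  refine Finset.sum_le_sum fun d _ => ?_
  split_ifs with h
  · nlinarith [h1 d]
  · exact mul_nonneg (not_le.1 h).le (h0 d)

theorem aCoeff_nonneg (p j k : Fin M) : 0 ≤ aCoeff u lam p j k := by
  unfold aCoeff
  split_ifs with h1 h2
  · exact mul_nonneg (nuPlus_nonneg p j) h2
  · exact mul_nonneg_of_nonpos_of_nonpos (nuMinus_nonpos p j) (not_le.1 h2).le
  · exact mul_nonneg (le_max_of_le_left (abs_nonneg _)) (abs_nonneg _)

/-- This explains the three cases of `aCoeff`. For `lam p * lam j ≥ 0` the sign of `u p k * u j k`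
decides which extreme of `y` matters; for a negative product the sign of the power alternates with
`s`, so both extremes must be covered. -/
theorem pow_mul_le_aCoeff {p j : Fin M} (k : Fin M) (s : ℕ) {y : ℝ}
    (h1 : nuMinus u p j ≤ y) (h2 : y ≤ nuPlus u p j) :
    (lam p * lam j) ^ s * (u p k * u j k * y) ≤ |lam p * lam j| ^ s * aCoeff u lam p j k := by
  unfold aCoeff
  split_ifs with h3 h4
  · rw [abs_of_nonneg h3, mul_comm (nuPlus u p j)]
    gcongr
  · rw [abs_of_nonneg h3, mul_comm (nuMinus u p j)]
    refine mul_le_mul_of_nonneg_left ?_ (pow_nonneg h3 s)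
    exact mul_le_mul_of_nonpos_left h1 (not_le.1 h4).le
  · refine (le_abs_self _).trans ?_
    rw [abs_mul, abs_pow, abs_mul _ y, mul_comm |u p k * u j k|]
    gcongr
    have h5 := nuPlus_nonneg (u := u) p j
    have h6 := nuMinus_nonpos (u := u) p j
    rw [abs_of_nonpos h6]
    refine abs_le.2 ⟨?_, h2.trans (le_max_right _ _)⟩
    linarith [le_max_left (-nuMinus u p j) (nuPlus u p j)]

theorem abs_sum_basis_mul_le {ξ : Fin M → ℝ} (h : ∀ d, |ξ d| ≤ 1) (p : Fin M) :
    |∑ d, u p d * ξ d| ≤ Real.sqrt M := by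
  refine Real.abs_le_sqrt ?_
  refine (Finset.sum_mul_sq_le_sq_mul_sq _ _ _).trans ?_
  have h1 : ∑ d, u p d ^ 2 = 1 := by simpa [sq] using basis_sum_mul u p p
  have h2 : ∑ d, ξ d ^ 2 ≤ ∑ _d : Fin M, (1 : ℝ) :=
    Finset.sum_le_sum fun d _ => (sq_le_one_iff_abs_le_one _).2 (h d)
  simpa [h1] using h2

variable [NeZero M] {G : SimpleGraph (Fin M)} [DecidableRel G.Adj] {κ : ℝ}

theorem epsN_nonneg (h : ∀ p : Fin M, p ≠ 0 → |lam p| < 1) : 0 ≤ epsN lam := by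
  refine mul_nonneg (Real.sqrt_nonneg _) (Finset.sum_nonneg fun p hp => ?_)
  have := h p (Finset.ne_of_mem_erase hp)
  exact div_nonneg (abs_nonneg _) (by linarith)

theorem epsC_nonneg (h : ∀ p j : Fin M, j ≠ 0 → |lam p * lam j| < 1) (k : Fin M) :
    0 ≤ epsC u lam k := by
  refine mul_nonneg (Nat.cast_nonneg _) (Finset.sum_nonneg fun p _ =>
    Finset.sum_nonneg fun j hj => ?_)
  have := h p j (Finset.ne_of_mem_erase hj)
  exact mul_nonneg (div_nonneg (abs_nonneg _) (by linarith)) (aCoeff_nonneg p j k)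

/-- Each agent's running estimate deviates from the network average by at most `ε_n`. -/
theorem abs_consensus_sub_average_le (hu : IsOrderedEigenbasis (consensusMatrix G κ) u lam)
    (hG : G.Connected) (hκ0 : 0 < κ) (hlam : ∀ k, -1 < lam k) {ξ : ℕ → Fin M → ℝ}
    (hξ : ∀ s d, |ξ s d| ≤ 1) (t : ℕ) (k : Fin M) :
    |∑ s ∈ Finset.range t, ∑ d, (consensusMatrix G κ ^ (t - s)) k d * ξ s d -
      (∑ s ∈ Finset.range t, ∑ d, ξ s d) / M| ≤ epsN lam := by
  -- The eigenvalue `1` part of each power has all entries `1 / M`, so it reproduces the average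
  -- exactly; only geometrically decaying modes remain.
  have key : ∑ s ∈ Finset.range t, ∑ d, (consensusMatrix G κ ^ (t - s)) k d * ξ s d -
      (∑ s ∈ Finset.range t, ∑ d, ξ s d) / M =
      ∑ p ∈ Finset.univ.erase (0 : Fin M), ∑ s ∈ Finset.range t,
        lam p ^ (t - s) * (u p k * ∑ d, u p d * ξ s d) := by
    conv_rhs => rw [Finset.sum_comm]
    rw [Finset.sum_div, ← Finset.sum_sub_distrib]
    refine Finset.sum_congr rfl fun s _ => ?_
    rw [Finset.sum_div, ← Finset.sum_sub_distrib]
    simp_rw [Finset.mul_sum]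
    conv_rhs => rw [Finset.sum_comm]
    refine Finset.sum_congr rfl fun d _ => ?_
    rw [hu.pow_apply, ← Finset.add_sum_erase _ _ (Finset.mem_univ (0 : Fin M)), hu.lam_zero hκ0,
      hu.u_zero_mul hG hκ0, one_pow, add_mul, Finset.sum_mul]
    have : (1 : ℝ) * (1 / M) * ξ s d = ξ s d / M := by ring
    rw [this, add_sub_cancel_left]
    exact Finset.sum_congr rfl fun p _ => by ring
  rw [key, epsN, Finset.mul_sum]
  refine (Finset.abs_sum_le_sum_abs _ _).trans (Finset.sum_le_sum fun p hp => ?_)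
  have hp1 := hu.abs_lam_lt_one hG hκ0 hlam (Finset.ne_of_mem_erase hp)
  calc |∑ s ∈ Finset.range t, lam p ^ (t - s) * (u p k * ∑ d, u p d * ξ s d)|
      ≤ ∑ s ∈ Finset.range t, |lam p| ^ (t - s) * Real.sqrt M := by
        refine (Finset.abs_sum_le_sum_abs _ _).trans (Finset.sum_le_sum fun s _ => ?_)
        rw [abs_mul, abs_pow, abs_mul]
        gcongr
        exact (mul_le_of_le_one_left (abs_nonneg _) (basis_abs_le_one u p k)).trans
          (abs_sum_basis_mul_le (hξ s) p)
    _ ≤ Real.sqrt M * (|lam p| / (1 - |lam p|)) := by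
        rw [← Finset.sum_mul, mul_comm]
        gcongr
        exact geom_sum_le (abs_nonneg _) hp1 t

/-- The weighted squared consensus weights are controlled by the consensus estimate and `ε_c`. -/
theorem sum_sq_consensus_le (hu : IsOrderedEigenbasis (consensusMatrix G κ) u lam)
    (hG : G.Connected) (hκ0 : 0 < κ) (hlam : ∀ k, -1 < lam k) {ξ : ℕ → Fin M → ℝ}
    (hξ0 : ∀ s d, 0 ≤ ξ s d) (hξ1 : ∀ s d, ξ s d ≤ 1) (t : ℕ) (k : Fin M) :
    ∑ s ∈ Finset.range t, ∑ d, (consensusMatrix G κ ^ (t - s)) k d ^ 2 * ξ s d ≤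
      (∑ s ∈ Finset.range t, ∑ d, (consensusMatrix G κ ^ (t - s)) k d * ξ s d +
        epsC u lam k) / M := by
  have hM : (M : ℝ) ≠ 0 := NeZero.ne _
  -- Only one of the two factors is split into `1 / M` plus decaying modes. This is why in `epsC`
  -- the index `j` omits `0` while `p` runs over all modes.
  have hsq : ∀ s d, (consensusMatrix G κ ^ s) k d ^ 2 = (consensusMatrix G κ ^ s) k d / M +
      ∑ p, ∑ j ∈ Finset.univ.erase (0 : Fin M),
        (lam p * lam j) ^ s * (u p k * u j k * (u p d * u j d)) := by
    intro s d
    have h1 : (consensusMatrix G κ ^ s) k d = 1 / M +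
        ∑ j ∈ Finset.univ.erase (0 : Fin M), lam j ^ s * (u j k * u j d) := by
      rw [hu.pow_apply, ← Finset.add_sum_erase _ _ (Finset.mem_univ (0 : Fin M)), hu.lam_zero hκ0,
        hu.u_zero_mul hG hκ0, one_pow, one_mul]
    rw [sq]
    nth_rewrite 2 [h1]
    rw [mul_add, mul_one_div, hu.pow_apply, Finset.sum_mul]
    congr 1
    refine Finset.sum_congr rfl fun p _ => ?_
    rw [Finset.mul_sum]
    exact Finset.sum_congr rfl fun j _ => by rw [mul_pow]; ring
  have hstep : ∀ s ∈ Finset.range t, ∑ d, (consensusMatrix G κ ^ (t - s)) k d ^ 2 * ξ s d ≤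
      (∑ d, (consensusMatrix G κ ^ (t - s)) k d * ξ s d) / M +
      ∑ p, ∑ j ∈ Finset.univ.erase (0 : Fin M),
        |lam p * lam j| ^ (t - s) * aCoeff u lam p j k := by
    intro s _
    have h1 : ∑ d, (consensusMatrix G κ ^ (t - s)) k d ^ 2 * ξ s d =
        (∑ d, (consensusMatrix G κ ^ (t - s)) k d * ξ s d) / M +
        ∑ p, ∑ j ∈ Finset.univ.erase (0 : Fin M),
          (lam p * lam j) ^ (t - s) * (u p k * u j k * ∑ d, u p d * u j d * ξ s d) := by
      simp_rw [hsq, add_mul, Finset.sum_add_distrib, Finset.sum_div, Finset.sum_mul,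
        Finset.mul_sum]
      congr 1
      · exact Finset.sum_congr rfl fun d _ => by ring
      · rw [Finset.sum_comm]
        refine Finset.sum_congr rfl fun p _ => ?_
        rw [Finset.sum_comm]
        exact Finset.sum_congr rfl fun j _ => Finset.sum_congr rfl fun d _ => by ring
    rw [h1]
    refine add_le_add le_rfl (Finset.sum_le_sum fun p _ => Finset.sum_le_sum fun j _ => ?_)
    exact pow_mul_le_aCoeff k _ (nuMinus_le_sum_mul (hξ0 s) (hξ1 s) p j)
      (sum_mul_le_nuPlus (hξ0 s) (hξ1 s) p j)
  refine (Finset.sum_le_sum hstep).trans ?_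
  rw [Finset.sum_add_distrib, ← Finset.sum_div, add_div]
  gcongr
  rw [epsC, mul_div_cancel_left₀ _ hM, Finset.sum_comm]
  refine Finset.sum_le_sum fun p _ => ?_
  rw [Finset.sum_comm]
  refine Finset.sum_le_sum fun j hj => ?_
  rw [← Finset.sum_mul]
  gcongr
  · exact aCoeff_nonneg p j k
  · exact geom_sum_le (abs_nonneg _)
      (hu.abs_lam_mul_lt_one hG hκ0 hlam p (Finset.ne_of_mem_erase hj)) t

end Indices

/-! ### Tail series bounded by comparison with integrals -/

section Sums

/-- The integral comparison test on one interval, obtained from the mean value theorem with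
primitive `-H`, so that the bounds telescope. -/
theorem le_sub_of_hasDerivAt_neg {H h : ℝ → ℝ} {a b : ℝ} (hab : a < b)
    (hH : ∀ x ∈ Set.Icc a b, HasDerivAt H (-h x) x) (hh : ∀ x ∈ Set.Icc a b, h b ≤ h x) :
    h b * (b - a) ≤ H a - H b := by
  obtain ⟨c, hc, hc'⟩ := exists_hasDerivAt_eq_slope H (fun x => -h x) hab
    (fun x hx => (hH x hx).continuousAt.continuousWithinAt)
    (fun x hx => hH x (Set.Ioo_subset_Icc_self hx))
  have h1 : 0 < b - a := by linarith
  rw [eq_div_iff h1.ne'] at hc'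
  have h2 := mul_le_mul_of_nonneg_right (hh c (Set.Ioo_subset_Icc_self hc)) h1.le
  linarith

theorem sum_rpow_neg_le {γ : ℝ} (hγ : 1 < γ) (n : ℕ) :
    ∑ t ∈ Finset.Ico 2 n, (t : ℝ) ^ (-γ) ≤ 1 / (γ - 1) := by
  have hg : 0 < γ - 1 := by linarith
  have key : ∀ m : ℕ, ∑ t ∈ Finset.Ico 2 (m + 2), (t : ℝ) ^ (-γ) ≤
      1 / (γ - 1) - ((m : ℝ) + 1) ^ (1 - γ) / (γ - 1) := by
    intro m
    induction m with
    | zero => simp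
    | succ m ih =>
      rw [show m + 1 + 2 = (m + 2) + 1 by ring, Finset.sum_Ico_succ_top (by omega)]
      have hm : (0 : ℝ) ≤ m := Nat.cast_nonneg m
      have := le_sub_of_hasDerivAt_neg (H := fun x => x ^ (1 - γ) / (γ - 1))
        (h := fun x => x ^ (-γ)) (a := (m : ℝ) + 1) (b := (m : ℝ) + 2) (by linarith)
        (fun x hx => by
          have hx0 : x ≠ 0 := by linarith [hx.1]
          convert! (Real.hasDerivAt_rpow_const (p := 1 - γ) (Or.inl hx0)).div_const (γ - 1) using 1
          rw [show 1 - γ - 1 = -γ by ring]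
          field_simp
          ring)
        (fun x hx => Real.rpow_le_rpow_of_nonpos (by linarith [hx.1]) hx.2 (by linarith))
      push_cast
      rw [show (m : ℝ) + 1 + 1 = m + 2 by ring]
      rw [show (m : ℝ) + 2 - (m + 1) = 1 by ring, mul_one] at this
      linarith
  calc ∑ t ∈ Finset.Ico 2 n, (t : ℝ) ^ (-γ) ≤ ∑ t ∈ Finset.Ico 2 (n + 2), (t : ℝ) ^ (-γ) :=
        Finset.sum_le_sum_of_subset_of_nonneg (Finset.Ico_subset_Ico_right (by omega))
          fun t _ _ => by positivity
    _ ≤ _ := key n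
    _ ≤ _ := by
        have : 0 ≤ ((n : ℝ) + 1) ^ (1 - γ) / (γ - 1) := by positivity
        linarith

/-- The function `Real.log x * x ^ (-γ)` decreases only beyond `exp (1 / γ)`, which is below `3`.
The terms `2` and `3` are therefore estimated by hand and give the summand `1`; telescoping starts
at `3`. -/
theorem sum_log_mul_rpow_neg_le {γ : ℝ} (hγ : 1 < γ) (n : ℕ) :
    ∑ t ∈ Finset.Ico 2 n, Real.log t * (t : ℝ) ^ (-γ) ≤ 1 / (γ - 1) ^ 2 + 1 := by
  have hg : 0 < γ - 1 := by linarith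
  have hlog2 : Real.log 2 < 0.7 := Real.log_two_lt_d9.trans (by norm_num)
  have hlog3 : Real.log 3 < 1.4 := by
    have h1 : Real.log 3 ≤ Real.log (2 ^ 2) := Real.log_le_log (by norm_num) (by norm_num)
    rw [Real.log_pow] at h1
    push_cast at h1
    linarith
  have hlog2' : 0 ≤ Real.log 2 := Real.log_nonneg (by norm_num)
  have hlog3' : 0 ≤ Real.log 3 := Real.log_nonneg (by norm_num)
  have hexp : Real.exp γ⁻¹ ≤ 3 := by
    have h1 : Real.exp γ⁻¹ ≤ Real.exp 1 := Real.exp_le_exp.2 (inv_le_one_of_one_le₀ hγ.le)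
    linarith [Real.exp_one_lt_d9]
  have key : ∀ m : ℕ, ∑ t ∈ Finset.Ico 2 (m + 4), Real.log t * (t : ℝ) ^ (-γ) ≤
      1 / (γ - 1) ^ 2 + 1 - ((m : ℝ) + 3) ^ (1 - γ) *
        (Real.log ((m : ℝ) + 3) / (γ - 1) + 1 / (γ - 1) ^ 2) := by
    intro m
    induction m with
    | zero =>
      have h1 : Finset.Ico 2 (0 + 4) = {2, 3} := by decide
      rw [h1, Finset.sum_pair (by norm_num)]
      have h2 : (2 : ℝ) ^ (-γ) ≤ 1 / 2 := by
        calc (2 : ℝ) ^ (-γ) ≤ 2 ^ (-1 : ℝ) :=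
              Real.rpow_le_rpow_of_exponent_le (by norm_num) (by linarith)
          _ = 1 / 2 := by rw [Real.rpow_neg_one]; norm_num
      have h3 : (3 : ℝ) ^ (-γ) ≤ 1 / 3 := by
        calc (3 : ℝ) ^ (-γ) ≤ 3 ^ (-1 : ℝ) :=
              Real.rpow_le_rpow_of_exponent_le (by norm_num) (by linarith)
          _ = 1 / 3 := by rw [Real.rpow_neg_one]; norm_num
      -- The primitive at `3` is bounded by its value at `1`, through `1 + z ≤ exp z` with `z = (γ -
      -- 1) * Real.log 3`.
      have h4 : (3 : ℝ) ^ (1 - γ) * (Real.log 3 / (γ - 1) + 1 / (γ - 1) ^ 2) ≤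
          1 / (γ - 1) ^ 2 := by
        have h5 : Real.log 3 / (γ - 1) + 1 / (γ - 1) ^ 2 =
            ((γ - 1) * Real.log 3 + 1) / (γ - 1) ^ 2 := by field_simp
        rw [h5, ← mul_div_assoc]
        gcongr
        rw [Real.rpow_def_of_pos (by norm_num)]
        calc Real.exp (Real.log 3 * (1 - γ)) * ((γ - 1) * Real.log 3 + 1)
            ≤ Real.exp (Real.log 3 * (1 - γ)) * Real.exp ((γ - 1) * Real.log 3) := by
              gcongr; exact Real.add_one_le_exp _
          _ = 1 := by rw [← Real.exp_add]; ring_nf; exact Real.exp_zero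
      have h6 : Real.log 2 * (2 : ℝ) ^ (-γ) ≤ Real.log 2 * (1 / 2) := by gcongr
      have h7 : Real.log 3 * (3 : ℝ) ^ (-γ) ≤ Real.log 3 * (1 / 3) := by gcongr
      have h8 : (0 : ℝ) ≤ (3 : ℝ) ^ (1 - γ) * (Real.log 3 / (γ - 1) + 1 / (γ - 1) ^ 2) := by
        positivity
      have h9 : Real.log 2 * (2 : ℝ) ^ (-γ) + Real.log 3 * (3 : ℝ) ^ (-γ) ≤ 1 := by linarith
      push_cast
      rw [zero_add]
      linarith
    | succ m ih =>
      rw [show m + 1 + 4 = (m + 4) + 1 by ring, Finset.sum_Ico_succ_top (by omega)]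
      have hm : (0 : ℝ) ≤ m := Nat.cast_nonneg m
      have := le_sub_of_hasDerivAt_neg
        (H := fun x => x ^ (1 - γ) * (Real.log x / (γ - 1) + 1 / (γ - 1) ^ 2))
        (h := fun x => Real.log x * x ^ (-γ)) (a := (m : ℝ) + 3) (b := (m : ℝ) + 4) (by linarith)
        (fun x hx => by
          have hx0 : 0 < x := by linarith [hx.1]
          convert! (Real.hasDerivAt_rpow_const (p := 1 - γ) (Or.inl hx0.ne')).mul
            (((Real.hasDerivAt_log hx0.ne').div_const (γ - 1)).add_const (1 / (γ - 1) ^ 2)) using 1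
          rw [show 1 - γ - 1 = -γ by ring, show 1 - γ = -γ + 1 by ring, Real.rpow_add hx0,
            Real.rpow_one]
          field_simp
          ring)
        (fun x hx => by
          have h1 := Real.log_div_self_rpow_antitoneOn (a := γ) (by linarith)
            (show x ∈ Set.Ici (Real.exp γ⁻¹) from hexp.trans (by linarith [hx.1]))
            (show (m : ℝ) + 4 ∈ Set.Ici (Real.exp γ⁻¹) from hexp.trans (by linarith)) hx.2
          have h2 : 0 ≤ x := by linarith [hx.1]
          simpa only [Real.rpow_neg h2, Real.rpow_neg (show (0 : ℝ) ≤ m + 4 by linarith),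
            div_eq_mul_inv] using h1)
      push_cast
      rw [show (m : ℝ) + 1 + 3 = m + 4 by ring]
      rw [show (m : ℝ) + 4 - (m + 3) = 1 by ring, mul_one] at this
      linarith
  calc ∑ t ∈ Finset.Ico 2 n, Real.log t * (t : ℝ) ^ (-γ)
      ≤ ∑ t ∈ Finset.Ico 2 (n + 4), Real.log t * (t : ℝ) ^ (-γ) :=
        Finset.sum_le_sum_of_subset_of_nonneg (Finset.Ico_subset_Ico_right (by omega))
          fun t _ _ => mul_nonneg (Real.log_natCast_nonneg t) (by positivity)
    _ ≤ _ := key n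
    _ ≤ _ := by
        have h1 : (0 : ℝ) ≤ n := Nat.cast_nonneg n
        have h2 : 0 ≤ Real.log ((n : ℝ) + 3) := Real.log_nonneg (by linarith)
        have : 0 ≤ ((n : ℝ) + 3) ^ (1 - γ) *
          (Real.log ((n : ℝ) + 3) / (γ - 1) + 1 / (γ - 1) ^ 2) := by positivity
        linarith

end Sums

/-! ### Exponential supermartingale of the selected rewards -/

section Supermartingale

open scoped ENNReal

theorem IsSubGaussian.lintegral_exp_le {p : Measure ℝ} [IsProbabilityMeasure p] {σ : ℝ}
    (hp : IsSubGaussian p σ) (β : ℝ) :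
    ∫⁻ x, ENNReal.ofReal (Real.exp (β * (x - mean p) - σ ^ 2 * β ^ 2 / 2)) ∂p ≤ 1 := by
  have h1 : ∀ x, Real.exp (β * (x - mean p) - σ ^ 2 * β ^ 2 / 2) =
      Real.exp (-(mean p * β + σ ^ 2 * β ^ 2 / 2)) * Real.exp (β * x) := fun x => by
    rw [← Real.exp_add]; ring_nf
  simp_rw [h1]
  rw [← ofReal_integral_eq_lintegral_ofReal ((hp.integrable_exp β).const_mul _)
    (ae_of_all _ fun x => by positivity), integral_const_mul, ENNReal.ofReal_le_one,
    Real.exp_neg, inv_mul_le_iff₀ (Real.exp_pos _), mul_one]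
  exact (Real.log_le_iff_le_exp (mgf_pos (X := fun x : ℝ => x) (hp.integrable_exp β))).1
    (hp.cgf_le β)

variable {Ω : Type*} {M N : ℕ}

/-- The sigma-algebra generated by the reward vectors of a set of (time, agent) pairs. -/
abbrev rewardSigma (r : ℕ → Fin M → Fin N → Ω → ℝ) (S : Set (ℕ × Fin M)) : MeasurableSpace Ω :=
  ⨆ q ∈ S, MeasurableSpace.comap (fun ω i => r q.1 q.2 i ω) inferInstance

theorem rewardSigma_mono (r : ℕ → Fin M → Fin N → Ω → ℝ) {S S' : Set (ℕ × Fin M)} (h : S ⊆ S') :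
    rewardSigma r S ≤ rewardSigma r S' :=
  biSup_mono h

theorem measurable_reward (r : ℕ → Fin M → Fin N → Ω → ℝ) {S : Set (ℕ × Fin M)}
    {q : ℕ × Fin M} (hq : q ∈ S) (i : Fin N) : Measurable[rewardSigma r S] (r q.1 q.2 i) := by
  have h1 : MeasurableSpace.comap (fun ω i => r q.1 q.2 i ω) inferInstance ≤ rewardSigma r S :=
    le_iSup₂_of_le q hq le_rfl
  have h2 := (comap_measurable (fun ω i => r q.1 q.2 i ω)).mono h1 le_rfl
  exact (measurable_pi_apply i).comp h2

theorem pastRewards_le (r : ℕ → Fin M → Fin N → Ω → ℝ) (t : ℕ) :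
    pastRewards r t ≤ rewardSigma r {q | q.1 < t} := by
  refine iSup₂_le fun τ hτ => iSup₂_le fun k i => ?_
  exact (measurable_reward r (q := (τ, k)) (S := {q | q.1 < t}) hτ.2 i).comap_le

/-- The exponential factor contributed by one (possibly unselected) reward. -/
noncomputable def expFactor (b : ℝ) (σ m : ℝ) (sel : Prop) [Decidable sel] (x : ℝ) : ℝ≥0∞ :=
  if sel then ENNReal.ofReal (Real.exp (b * (x - m) - σ ^ 2 * b ^ 2 / 2)) else 1

theorem measurable_expFactor {mΩ : MeasurableSpace Ω} {c : Ω → Fin N} {X : Ω → ℝ}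
    (hc : Measurable c) (hX : Measurable X) (b σ m : ℝ) (i : Fin N) :
    Measurable fun ω => expFactor b σ m (c ω = i) (X ω) := by
  unfold expFactor
  refine Measurable.ite (hc (measurableSet_singleton i)) ?_ measurable_const
  fun_prop

/-- One supermartingale step without conditional expectations: the event `c = i` is known in `m₁`.
On it the independent factor `Y` has mean at most `1`; off it the factor is `1`. -/
theorem lintegral_mul_ite_le_of_indep {m₁ m₂ mΩ : MeasurableSpace Ω} {μ : Measure Ω} (h₁ : m₁ ≤ mΩ)
    (h₂ : m₂ ≤ mΩ) (hind : Indep m₁ m₂ μ) {F Y : Ω → ℝ≥0∞} (hF : Measurable[m₁] F)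
    (hY : Measurable[m₂] Y) (hY1 : ∫⁻ ω, Y ω ∂μ ≤ 1) {c : Ω → Fin N} (hc : Measurable[m₁] c)
    (i : Fin N) : ∫⁻ ω, F ω * (if c ω = i then Y ω else 1) ∂μ ≤ ∫⁻ ω, F ω ∂μ := by
  have hA : MeasurableSet[m₁] (c ⁻¹' {i}) := hc (measurableSet_singleton i)
  have hA' : MeasurableSet (c ⁻¹' {i}) := h₁ _ hA
  have hsplit : ∀ ω, F ω * (if c ω = i then Y ω else 1) =
      (c ⁻¹' {i}).indicator F ω * Y ω + (c ⁻¹' {i})ᶜ.indicator F ω := by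
    intro ω
    by_cases h : c ω = i <;> simp [Set.indicator, h]
  simp_rw [hsplit]
  rw [lintegral_add_right _ ((hF.mono h₁ le_rfl).indicator hA'.compl),
    lintegral_mul_eq_lintegral_mul_lintegral_of_independent_measurableSpace h₁ h₂ hind
      (Measurable.indicator hF hA) hY]
  calc _ ≤ (∫⁻ ω, (c ⁻¹' {i}).indicator F ω ∂μ) * 1 + ∫⁻ ω, (c ⁻¹' {i})ᶜ.indicator F ω ∂μ := by
        gcongr
    _ = ∫⁻ ω, F ω ∂μ := by
      rw [mul_one, lintegral_indicator hA', lintegral_indicator hA'.compl, lintegral_add_compl _ hA']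

variable [MeasurableSpace Ω] {μ : Measure Ω} {p : Fin N → Measure ℝ} {σ : ℝ}
  {r : ℕ → Fin M → Fin N → Ω → ℝ}

theorem IsRewardProcess.rewardSigma_le (hr : IsRewardProcess μ p r) (S : Set (ℕ × Fin M)) :
    rewardSigma r S ≤ ‹MeasurableSpace Ω› :=
  iSup₂_le fun q _ => (measurable_pi_lambda _ fun i => hr.measurable q.1 q.2 i).comap_le

theorem IsRewardProcess.indep_rewardSigma (hr : IsRewardProcess μ p r) {S S' : Set (ℕ × Fin M)}
    (h : Disjoint S S') : Indep (rewardSigma r S) (rewardSigma r S') μ := by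
  have hle : ∀ q : ℕ × Fin M, MeasurableSpace.comap (fun ω i => r q.1 q.2 i ω) inferInstance ≤
      ‹MeasurableSpace Ω› := fun q =>
    (measurable_pi_lambda _ fun i => hr.measurable q.1 q.2 i).comap_le
  have hi : iIndep (fun q : ℕ × Fin M =>
      MeasurableSpace.comap (fun ω i => r q.1 q.2 i ω) inferInstance) μ :=
    hr.indep.iIndep
  exact indep_iSup_of_disjoint (m := fun q : ℕ × Fin M =>
      MeasurableSpace.comap (fun ω i => r q.1 q.2 i ω) inferInstance) hle hi h

variable [IsProbabilityMeasure μ]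

theorem IsRewardProcess.lintegral_mul_expFactor_le (hr : IsRewardProcess μ p r)
    (hp : ∀ i, IsSubGaussian (p i) σ) {S : Set (ℕ × Fin M)} {q : ℕ × Fin M} (hq : q ∉ S)
    {F : Ω → ℝ≥0∞} (hF : Measurable[rewardSigma r S] F) {c : Ω → Fin N}
    (hc : Measurable[rewardSigma r S] c) (b : ℝ) (i : Fin N) :
    ∫⁻ ω, F ω * expFactor b σ (mean (p i)) (c ω = i) (r q.1 q.2 i ω) ∂μ ≤ ∫⁻ ω, F ω ∂μ := by
  have hY : Measurable fun x : ℝ =>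
      ENNReal.ofReal (Real.exp (b * (x - mean (p i)) - σ ^ 2 * b ^ 2 / 2)) := by fun_prop
  have hind : Indep (rewardSigma r S) (rewardSigma r {q}) μ :=
    hr.indep_rewardSigma (Set.disjoint_singleton_right.2 hq)
  have hprob : IsProbabilityMeasure (p i) := by
    rw [← hr.law q.1 q.2 i]
    exact Measure.isProbabilityMeasure_map (hr.measurable q.1 q.2 i).aemeasurable
  have hYq : Measurable[rewardSigma r {q}] fun ω =>
      ENNReal.ofReal (Real.exp (b * (r q.1 q.2 i ω - mean (p i)) - σ ^ 2 * b ^ 2 / 2)) :=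
    hY.comp (measurable_reward r (Set.mem_singleton q) i)
  have hY1 : ∫⁻ ω, ENNReal.ofReal (Real.exp (b * (r q.1 q.2 i ω - mean (p i)) -
      σ ^ 2 * b ^ 2 / 2)) ∂μ ≤ 1 := by
    have h := lintegral_map (μ := μ) hY (hr.measurable q.1 q.2 i)
    rw [hr.law] at h
    exact h.symm.le.trans ((hp i).lintegral_exp_le b)
  exact lintegral_mul_ite_le_of_indep (hr.rewardSigma_le S) (hr.rewardSigma_le {q}) hind hF
    hYq hY1 hc i

/-- The exponential process of the selected, centred and weighted rewards has mean at most `1`. -/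
theorem IsRewardProcess.lintegral_prod_expFactor_le (hr : IsRewardProcess μ p r)
    (hp : ∀ i, IsSubGaussian (p i) σ) {a : ℕ → Fin M → Ω → Fin N}
    (ha : ∀ t k, 1 ≤ t → Measurable[pastRewards r t] (a t k)) (b : ℕ → Fin M → ℝ) (i : Fin N)
    (t : ℕ) :
    Measurable[rewardSigma r {q | q.1 < t + 1}] (fun ω => ∏ s ∈ Finset.range t, ∏ d,
        expFactor (b s d) σ (mean (p i)) (a (s + 1) d ω = i) (r (s + 1) d i ω)) ∧
    ∫⁻ ω, ∏ s ∈ Finset.range t, ∏ d,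
      expFactor (b s d) σ (mean (p i)) (a (s + 1) d ω = i) (r (s + 1) d i ω) ∂μ ≤ 1 := by
  induction t with
  | zero => simp
  | succ t ih =>
    obtain ⟨hF, hF1⟩ := ih
    set F : Ω → ℝ≥0∞ := fun ω => ∏ s ∈ Finset.range t, ∏ d,
        expFactor (b s d) σ (mean (p i)) (a (s + 1) d ω = i) (r (s + 1) d i ω)
    have hc : ∀ d, Measurable[rewardSigma r {q | q.1 < t + 1}] (a (t + 1) d) := fun d =>
      (ha (t + 1) d (by omega)).mono (pastRewards_le r _) le_rfl
    -- Agents of one round are added one at a time. All selections of the round depend on earlier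
    -- rewards only, so each new reward is independent of the accumulated product and of the
    -- selection that gates it.
    have key : ∀ D : Finset (Fin M),
        Measurable[rewardSigma r {q | q.1 < t + 1 ∨ q.1 = t + 1 ∧ q.2 ∈ D}] (fun ω => F ω * ∏ d ∈ D,
          expFactor (b t d) σ (mean (p i)) (a (t + 1) d ω = i) (r (t + 1) d i ω)) ∧
        ∫⁻ ω, F ω * ∏ d ∈ D,
          expFactor (b t d) σ (mean (p i)) (a (t + 1) d ω = i) (r (t + 1) d i ω) ∂μ ≤ 1 := by
      intro D
      induction D using Finset.induction_on with
      | empty =>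
        simp only [Finset.prod_empty, mul_one]
        exact ⟨hF.mono (rewardSigma_mono r fun q h => Or.inl h) le_rfl, hF1⟩
      | insert d D hd ihD =>
        obtain ⟨hm, hle⟩ := ihD
        have heq : ∀ ω, F ω * ∏ d ∈ insert d D,
            expFactor (b t d) σ (mean (p i)) (a (t + 1) d ω = i) (r (t + 1) d i ω) =
            (F ω * ∏ d ∈ D,
            expFactor (b t d) σ (mean (p i)) (a (t + 1) d ω = i) (r (t + 1) d i ω)) *
            expFactor (b t d) σ (mean (p i)) (a (t + 1) d ω = i) (r (t + 1) d i ω) := by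
          intro ω
          rw [Finset.prod_insert hd]
          ring
        simp_rw [heq]
        constructor
        · have hsub : {q : ℕ × Fin M | q.1 < t + 1 ∨ q.1 = t + 1 ∧ q.2 ∈ D} ⊆
              {q | q.1 < t + 1 ∨ q.1 = t + 1 ∧ q.2 ∈ insert d D} := by
            rintro q (h | ⟨h1, h2⟩)
            · exact Or.inl h
            · exact Or.inr ⟨h1, Finset.mem_insert_of_mem h2⟩
          have hsub' : {q : ℕ × Fin M | q.1 < t + 1} ⊆
              {q | q.1 < t + 1 ∨ q.1 = t + 1 ∧ q.2 ∈ insert d D} := fun q h => Or.inl h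
          refine Measurable.mul (hm.mono (rewardSigma_mono r hsub) le_rfl) ?_
          exact measurable_expFactor ((hc d).mono (rewardSigma_mono r hsub') le_rfl)
            (measurable_reward r (q := (t + 1, d)) (Or.inr ⟨rfl, Finset.mem_insert_self d D⟩) i)
            _ _ _ _
        · refine (hr.lintegral_mul_expFactor_le hp (q := (t + 1, d)) ?_ hm
            ((hc d).mono (rewardSigma_mono r fun q h => Or.inl h) le_rfl) _ i).trans hle
          rintro (h | ⟨-, h⟩)
          · exact lt_irrefl _ h
          · exact hd h
    obtain ⟨hm, hle⟩ := key Finset.univ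
    simp_rw [Finset.prod_range_succ]
    refine ⟨hm.mono (rewardSigma_mono r ?_) le_rfl, hle⟩
    rintro q (h | ⟨h, -⟩)
    · exact Nat.lt_succ_of_lt h
    · exact h ▸ Nat.lt_succ_self _

end Supermartingale

/-! ### Peeling over geometric cells and the confidence radius -/

section Peeling

theorem gEta_pos {η : ℝ} (hη0 : 0 < η) (hη4 : η < 4) : 0 < gEta η := by
  unfold gEta
  nlinarith

/-- Bernoulli gives `1 + η ≤ (1 + η / 4) ^ 4`, hence `|x - 1| ≤ η / 4`, and `x - x ^ 2 / 2 = (1 - (x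
- 1) ^ 2) / 2`. This is the origin of `gEta`. -/
theorem gEta_div_two_le {η x : ℝ} (hη0 : 0 < η) (hx : 0 ≤ x)
    (h1 : 1 ≤ x ^ 4 * (1 + η)) (h2 : x ^ 4 ≤ 1 + η) : gEta η / 2 ≤ x - x ^ 2 / 2 := by
  have h3 : 1 + η ≤ (1 + η / 4) ^ 4 := by
    have := one_add_mul_le_pow (a := η / 4) (by linarith) 4
    push_cast at this
    linarith
  have h4 : x ≤ 1 + η / 4 :=
    (pow_le_pow_iff_left₀ hx (by positivity) (by norm_num : 4 ≠ 0)).1 (h2.trans h3)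
  have h5 : 1 ≤ x * (1 + η / 4) := by
    refine (pow_le_pow_iff_left₀ zero_le_one (by positivity) (by norm_num : 4 ≠ 0)).1 ?_
    rw [one_pow, mul_pow]
    exact h1.trans (by gcongr)
  have h6 : 1 - η / 4 ≤ x := by nlinarith
  unfold gEta
  nlinarith

/-- The exponential tilt used on one cell `[w, w (1 + η)]` of the peeling. -/
noncomputable def cellTilt (σ η δ w : ℝ) : ℝ := δ / (σ * Real.sqrt (w * Real.sqrt (1 + η)))

/-- The ideal tilt `δ / (σ * √W)` would give the exponent `δ ^ 2 / 2`. Replacing the unknown `W` by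
the geometric midpoint of its cell costs at most the factor `gEta η`. -/
theorem exp_le_exp_cellTilt {σ η δ w S V W : ℝ} (hσ : 0 < σ) (hη0 : 0 < η)
    (hδ : 0 ≤ δ) (hw : 0 < w) (h1 : w ≤ W) (h2 : W ≤ w * (1 + η)) (hV : V ≤ W)
    (hS : σ * δ * Real.sqrt W ≤ S) :
    Real.exp (δ ^ 2 * (gEta η / 2)) ≤
      Real.exp (cellTilt σ η δ w * S - σ ^ 2 * cellTilt σ η δ w ^ 2 / 2 * V) := by
  set c := Real.sqrt (1 + η) with hc
  have hc0 : 0 < c := Real.sqrt_pos.2 (by linarith)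
  have hc2 : c ^ 2 = 1 + η := Real.sq_sqrt (by linarith)
  set q := Real.sqrt (w * c) with hq
  have hq0 : 0 < q := Real.sqrt_pos.2 (by positivity)
  have hq2 : q ^ 2 = w * c := Real.sq_sqrt (by positivity)
  have hW0 : 0 < W := hw.trans_le h1
  set y := Real.sqrt W with hy
  have hy0 : 0 < y := Real.sqrt_pos.2 hW0
  have hy2 : y ^ 2 = W := Real.sq_sqrt hW0.le
  have hq4 : q ^ 4 = w ^ 2 * (1 + η) := by
    rw [show q ^ 4 = (q ^ 2) ^ 2 by ring, hq2, mul_pow, hc2]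
  have hy4 : y ^ 4 = W ^ 2 := by rw [show y ^ 4 = (y ^ 2) ^ 2 by ring, hy2]
  have hx := gEta_div_two_le (x := y / q) hη0 (by positivity)
    (by
      rw [div_pow, hq4, hy4, div_mul_eq_mul_div, le_div_iff₀ (by positivity), one_mul]
      gcongr)
    (by
      rw [div_pow, hq4, hy4, div_le_iff₀ (by positivity)]
      calc W ^ 2 ≤ (w * (1 + η)) ^ 2 := by gcongr
        _ = _ := by ring)
  refine Real.exp_le_exp.2 ?_
  have ht : cellTilt σ η δ w = δ / (σ * q) := rfl
  rw [ht]
  have e1 : δ ^ 2 * (y / q) ≤ δ / (σ * q) * S := by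
    calc δ ^ 2 * (y / q) = δ / (σ * q) * (σ * δ * y) := by field_simp
      _ ≤ _ := by gcongr
  have e2 : σ ^ 2 * (δ / (σ * q)) ^ 2 / 2 * V ≤ δ ^ 2 * ((y / q) ^ 2 / 2) := by
    calc σ ^ 2 * (δ / (σ * q)) ^ 2 / 2 * V ≤ σ ^ 2 * (δ / (σ * q)) ^ 2 / 2 * y ^ 2 := by
          rw [hy2]; gcongr
      _ = _ := by field_simp
  have e3 := mul_le_mul_of_nonneg_left hx (sq_nonneg δ)
  linarith

/-- The number of cells needed to peel an interval of ratio `t`. -/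
noncomputable def cellCount (η t : ℝ) : ℕ := ⌊Real.log t / Real.log (1 + η)⌋₊ + 1

theorem cellCount_le {η t : ℝ} (hη0 : 0 < η) (ht : 1 ≤ t) :
    (cellCount η t : ℝ) ≤ Real.log t / Real.log (1 + η) + 1 := by
  have h1 : 0 < Real.log (1 + η) := Real.log_pos (by linarith)
  have h2 : 0 ≤ Real.log t := Real.log_nonneg ht
  unfold cellCount
  push_cast
  gcongr
  exact Nat.floor_le (by positivity)

/-- The exponential tilt on the cell with index `l`, at time `t` and when `f t = φ`. -/
noncomputable def tilt (M : ℕ) (σ γ η φ t : ℝ) (l : ℕ) : ℝ :=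
  cellTilt σ η (Real.sqrt (2 * γ * Real.log t / gEta η)) ((1 + φ) / M * (1 + η) ^ l)

/-- As `n` runs from `1` to `t`, the ratio `(n + φ) / (1 + φ)` stays between `1` and `t`, so
`cellCount η t` cells suffice. The exponential of the cell containing it is at least `t ^ γ`, and
the others are nonnegative. -/
theorem one_le_sum_exp_tilt {M : ℕ} [NeZero M] {σ γ η φ t n S V : ℝ} (hσ : 0 < σ) (hγ : 1 < γ)
    (hη0 : 0 < η) (hη4 : η < 4) (hφ : 0 ≤ φ) (hn : 1 ≤ n) (hnt : n ≤ t)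
    (hV : V ≤ (n + φ) / M)
    (hS : σ * Real.sqrt (2 * γ / gEta η * ((n + φ) / (M * n)) * (Real.log t / n)) ≤ S / n) :
    1 ≤ t ^ (-γ) * ∑ l ∈ Finset.range (cellCount η t), Real.exp (tilt M σ γ η φ t l * S -
      σ ^ 2 * tilt M σ γ η φ t l ^ 2 / 2 * V) := by
  have hM : (0 : ℝ) < M := Nat.cast_pos.2 (NeZero.pos M)
  have hG := gEta_pos hη0 hη4
  have ht0 : 0 < t := by linarith
  have hlog : 0 ≤ Real.log t := Real.log_nonneg (hn.trans hnt)
  have hn0 : 0 < n := by linarith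
  have hφ1 : 0 < 1 + φ := by linarith
  obtain ⟨l, hl1, hl2⟩ := exists_nat_pow_near (x := (n + φ) / (1 + φ)) (y := 1 + η)
    ((one_le_div hφ1).2 (by linarith)) (by linarith)
  have hlmem : l ∈ Finset.range (cellCount η t) := by
    rw [Finset.mem_range, cellCount, Nat.lt_succ_iff]
    refine Nat.le_floor ?_
    rw [le_div_iff₀ (Real.log_pos (by linarith)), ← Real.log_pow]
    refine Real.log_le_log (by positivity) (hl1.trans ?_)
    rw [div_le_iff₀ hφ1]
    nlinarith
  set δ := Real.sqrt (2 * γ * Real.log t / gEta η) with hδ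
  have hδ2 : δ ^ 2 = 2 * γ * Real.log t / gEta η := Real.sq_sqrt (by positivity)
  have hcell := exp_le_exp_cellTilt (w := (1 + φ) / M * (1 + η) ^ l) (W := (n + φ) / M) (S := S)
    (V := V) hσ hη0 (Real.sqrt_nonneg _ : 0 ≤ δ) (by positivity)
    (by
      rw [le_div_iff₀ hφ1] at hl1
      rw [div_mul_eq_mul_div]
      gcongr
      linarith)
    (by
      rw [div_lt_iff₀ hφ1, pow_succ] at hl2
      rw [div_mul_eq_mul_div, div_mul_eq_mul_div]
      gcongr
      linarith)
    hV
    (by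
      have h1 : 2 * γ / gEta η * ((n + φ) / (M * n)) * (Real.log t / n) =
          (2 * γ * Real.log t / gEta η) * ((n + φ) / M) / n ^ 2 := by field_simp
      rw [h1, Real.sqrt_div' _ (by positivity), Real.sqrt_sq hn0.le, Real.sqrt_mul (by positivity),
        ← mul_div_assoc, div_le_div_iff_of_pos_right hn0, ← mul_assoc] at hS
      exact hS)
  -- The choice of `δ` in `tilt` is made so that `exp (δ ^ 2 * gEta η / 2)` equals `t ^ γ`.
  have hpow : t ^ (-γ) * Real.exp (δ ^ 2 * (gEta η / 2)) = 1 := by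
    rw [hδ2, Real.rpow_def_of_pos ht0, ← Real.exp_add, Real.exp_eq_one_iff]
    field_simp
    ring
  rw [← hpow]
  gcongr
  exact hcell.trans (Finset.single_le_sum (f := fun l => Real.exp (tilt M σ γ η φ t l * S -
      σ ^ 2 * tilt M σ γ η φ t l ^ 2 / 2 * V)) (fun _ _ => (Real.exp_pos _).le) hlmem)

/-- Once an arm has been sampled often enough, its confidence radius is at most half the gap. -/
theorem two_mul_radius_le {M : ℕ} [NeZero M] {σ γ g Δ φ F l L n : ℝ} (hσ : 0 < σ) (hγ : 1 < γ)
    (hg : 0 < g) (hΔ : 0 < Δ) (hφ : 0 ≤ φ) (hφF : φ ≤ F) (hl : 0 < l) (hlL : l ≤ L) (hn : 0 < n)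
    (h : 4 * σ ^ 2 * γ * L / (Δ ^ 2 * g) *
      (1 + Real.sqrt (1 + Δ ^ 2 * M * g / (2 * γ * σ ^ 2) * (F / L))) ≤ M * n) :
    2 * (σ * Real.sqrt (2 * γ / g * ((n + φ) / (M * n)) * (l / n))) ≤ Δ := by
  have hM : (0 : ℝ) < M := Nat.cast_pos.2 (NeZero.pos M)
  have hL : 0 < L := hl.trans_le hlL
  have hF : 0 ≤ F := hφ.trans hφF
  have hγ0 : 0 < γ := by linarith
  -- With `F` and `L` in place of `φ` and `l`, the claim reads `2 * A * (n + F) ≤ n ^ 2`, and the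
  -- positive root of this quadratic is `A * (1 + √(1 + 2 * F / A))`.
  set A := 4 * σ ^ 2 * γ * L / (Δ ^ 2 * g) / M with hA
  have hA0 : 0 < A := by positivity
  have h1 : Δ ^ 2 * M * g / (2 * γ * σ ^ 2) * (F / L) = 2 * F / A := by
    rw [hA]; field_simp; ring
  set q := Real.sqrt (1 + 2 * F / A) with hq
  have hq0 : 0 ≤ q := Real.sqrt_nonneg _
  have hq2 : A ^ 2 * q ^ 2 = A ^ 2 + 2 * F * A := by
    rw [hq, Real.sq_sqrt (by positivity)]; field_simp
  have h2 : A * (1 + q) ≤ n := by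
    rw [h1] at h
    have : 4 * σ ^ 2 * γ * L / (Δ ^ 2 * g) = M * A := by rw [hA]; field_simp
    rw [this, mul_assoc] at h
    exact le_of_mul_le_mul_left h hM
  have h3 : 2 * A * (n + F) ≤ n ^ 2 := by
    have h4 : (A * q) ^ 2 ≤ (n - A) ^ 2 := by
      have : 0 ≤ A * q := by positivity
      gcongr
      linarith
    nlinarith
  have h5 : Real.sqrt (2 * γ / g * ((n + φ) / (M * n)) * (l / n)) ≤ Δ / (2 * σ) := by
    refine Real.sqrt_le_iff.2 ⟨by positivity, ?_⟩
    calc 2 * γ / g * ((n + φ) / (M * n)) * (l / n) ≤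
          2 * γ / g * ((n + F) / (M * n)) * (L / n) := by gcongr
      _ = Δ ^ 2 / (4 * σ ^ 2) * (2 * A * (n + F) / n ^ 2) := by rw [hA]; field_simp
      _ ≤ Δ ^ 2 / (4 * σ ^ 2) * 1 := by
          gcongr
          exact (div_le_one (by positivity)).2 h3
      _ = _ := by ring
  calc 2 * (σ * Real.sqrt (2 * γ / g * ((n + φ) / (M * n)) * (l / n))) ≤
        2 * (σ * (Δ / (2 * σ))) := by gcongr
    _ = Δ := by field_simp

end Peeling

/-! ### Counting early rounds and bounding a growing count -/

section Counting

theorem card_lt_le_tDagger {t₀ : ℝ} (ht0 : 0 ≤ t₀) {f : ℝ → ℝ}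
    (hf : MonotoneOn f (Set.Ici t₀)) {e : ℝ} (he : ∃ t, t₀ ≤ t ∧ e ≤ f t) (T : ℕ) :
    (((Finset.Ico 2 T).filter fun t : ℕ => f t < e).card : ℝ) ≤ tDagger t₀ f e := by
  have h0 : 0 ≤ tDagger t₀ f e := Real.sInf_nonneg fun t ht => ht0.trans ht.1
  have hsub : ((Finset.Ico 2 T).filter fun t : ℕ => f t < e) ⊆
      Finset.Icc 1 ⌊tDagger t₀ f e⌋₊ := by
    intro t ht
    obtain ⟨ht2, hte⟩ := Finset.mem_filter.1 ht
    have ht2' := (Finset.mem_Ico.1 ht2).1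
    refine Finset.mem_Icc.2 ⟨by omega, Nat.le_floor ?_⟩
    by_contra! hlt
    obtain ⟨s, hs, hst⟩ := exists_lt_of_csInf_lt (s := {t : ℝ | t₀ ≤ t ∧ e ≤ f t}) he hlt
    have h1 : t₀ ≤ (t : ℝ) := hs.1.trans hst.le
    exact absurd (hs.2.trans (hf hs.1 h1 hst.le)) (not_le.2 hte)
  calc (((Finset.Ico 2 T).filter fun t : ℕ => f t < e).card : ℝ)
      ≤ (Finset.Icc 1 ⌊tDagger t₀ f e⌋₊).card := by exact_mod_cast Finset.card_le_card hsub
    _ = ⌊tDagger t₀ f e⌋₊ := by simp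
    _ ≤ _ := Nat.floor_le h0

/-- The step that leaves the region `y ≤ A` ends at most at `A + B`; all later growth is charged to
`b`. -/
theorem le_add_sum_of_step {y b : ℕ → ℝ} {A B : ℝ} (hA : 0 ≤ A) (hB : 0 ≤ B) (hy0 : y 0 = 0)
    (hb : ∀ n, 0 ≤ b n) (T : ℕ) (h1 : ∀ n < T, y (n + 1) ≤ y n + B)
    (h2 : ∀ n < T, A < y n → y (n + 1) ≤ y n ∨ 2 ≤ n ∧ y (n + 1) ≤ y n + b n) :
    y T ≤ A + B + ∑ t ∈ Finset.Ico 2 T, b t := by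
  suffices h : ∀ n ≤ T, y n ≤ A + B + ∑ t ∈ Finset.Ico 2 n, b t from h T le_rfl
  intro n
  induction n with
  | zero => intro _; simp [hy0]; linarith
  | succ n ih =>
    intro hn
    rcases le_or_gt (y n) A with h | h
    · have := Finset.sum_nonneg fun t (_ : t ∈ Finset.Ico 2 (n + 1)) => hb t
      linarith [h1 n hn]
    · rcases h2 n hn h with h3 | ⟨h3, h4⟩
      · have : ∑ t ∈ Finset.Ico 2 n, b t ≤ ∑ t ∈ Finset.Ico 2 (n + 1), b t :=
          Finset.sum_le_sum_of_subset_of_nonneg (Finset.Ico_subset_Ico_right n.le_succ)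
            fun t _ _ => hb t
        linarith [ih (by omega)]
      · rw [Finset.sum_Ico_succ_top h3]
        linarith [ih (by omega)]

end Counting

/-! ### Centred estimation error and its exponential process -/

section Noise

variable {M N : ℕ}

/-- The centred part of the estimate `ŝ_i^k(t)`. -/
noncomputable def noise (P : Matrix (Fin M) (Fin M) ℝ) (m : ℝ) (x : ℕ → Fin M → Fin N → ℝ)
    (a : ℕ → Fin M → Fin N) (i : Fin N) (t : ℕ) (k : Fin M) : ℝ :=
  ∑ s ∈ Finset.range t, ∑ d, (P ^ (t - s)) k d * (if a (s + 1) d = i then x (s + 1) d i - m else 0)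

/-- The variance proxy of `noise`, per unit of reward variance. -/
noncomputable def energy (P : Matrix (Fin M) (Fin M) ℝ) (a : ℕ → Fin M → Fin N) (i : Fin N) (t : ℕ)
    (k : Fin M) : ℝ :=
  ∑ s ∈ Finset.range t, ∑ d, (P ^ (t - s)) k d ^ 2 * (if a (s + 1) d = i then 1 else 0)

theorem sHat_eq_noise_add (P : Matrix (Fin M) (Fin M) ℝ) (m : ℝ) (x : ℕ → Fin M → Fin N → ℝ)
    (a : ℕ → Fin M → Fin N) (i : Fin N) (t : ℕ) (k : Fin M) :
    sHat P x a i t k = noise P m x a i t k + m * nHat P a i t k := by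
  rw [sHat_eq, nHat_eq, noise, Finset.mul_sum, ← Finset.sum_add_distrib]
  refine Finset.sum_congr rfl fun s _ => ?_
  rw [Finset.mul_sum, ← Finset.sum_add_distrib]
  refine Finset.sum_congr rfl fun d _ => ?_
  split_ifs <;> ring

/-- The exponential process of `noise` with tilt `θ`. -/
noncomputable def expProcess (P : Matrix (Fin M) (Fin M) ℝ) (σ m : ℝ) (x : ℕ → Fin M → Fin N → ℝ)
    (a : ℕ → Fin M → Fin N) (i : Fin N) (t : ℕ) (k : Fin M) (θ : ℝ) : ℝ :=
  Real.exp (θ * noise P m x a i t k - σ ^ 2 * θ ^ 2 / 2 * energy P a i t k)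

/-- The final time `t` is frozen, so the weights are deterministic and the exponential factors over
pairs `(s, d)`. As `t` varies the weights change, so the one-step argument runs in `s` and not in
`t`. -/
theorem ofReal_expProcess (P : Matrix (Fin M) (Fin M) ℝ) (σ m : ℝ) (x : ℕ → Fin M → Fin N → ℝ)
    (a : ℕ → Fin M → Fin N) (i : Fin N) (t : ℕ) (k : Fin M) (θ : ℝ) :
    ENNReal.ofReal (expProcess P σ m x a i t k θ) = ∏ s ∈ Finset.range t, ∏ d,
      expFactor (θ * (P ^ (t - s)) k d) σ m (a (s + 1) d = i) (x (s + 1) d i) := by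
  have h1 : ∀ s d, expFactor (θ * (P ^ (t - s)) k d) σ m (a (s + 1) d = i) (x (s + 1) d i) =
      ENNReal.ofReal (Real.exp
        (θ * ((P ^ (t - s)) k d * (if a (s + 1) d = i then x (s + 1) d i - m else 0)) -
        σ ^ 2 * θ ^ 2 / 2 * ((P ^ (t - s)) k d ^ 2 * (if a (s + 1) d = i then 1 else 0)))) := by
    intro s d
    unfold expFactor
    split_ifs
    · congr 2; ring
    · simp
  simp_rw [h1]
  simp_rw [← ENNReal.ofReal_prod_of_nonneg fun d (_ : d ∈ Finset.univ) =>
    (Real.exp_pos _).le, ← Real.exp_sum]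
  rw [← ENNReal.ofReal_prod_of_nonneg fun d _ => (Real.exp_pos _).le, ← Real.exp_sum, expProcess,
    noise, energy]
  simp_rw [Finset.sum_sub_distrib, ← Finset.mul_sum]

variable {Ω : Type*} [MeasurableSpace Ω] {μ : Measure Ω} [IsProbabilityMeasure μ]
  {p : Fin N → Measure ℝ} {σ : ℝ} {r : ℕ → Fin M → Fin N → Ω → ℝ}

theorem IsRewardProcess.integral_expProcess_le (hr : IsRewardProcess μ p r)
    (hp : ∀ i, IsSubGaussian (p i) σ) {a : ℕ → Fin M → Ω → Fin N}
    (ha : ∀ t k, 1 ≤ t → Measurable[pastRewards r t] (a t k)) (P : Matrix (Fin M) (Fin M) ℝ)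
    (i : Fin N) (t : ℕ) (k : Fin M) (θ : ℝ) :
    Integrable (fun ω => expProcess P σ (mean (p i)) (fun s l j => r s l j ω)
      (fun s l => a s l ω) i t k θ) μ ∧
    ∫ ω, expProcess P σ (mean (p i)) (fun s l j => r s l j ω) (fun s l => a s l ω) i t k θ ∂μ
      ≤ 1 := by
  obtain ⟨hm, hle⟩ := hr.lintegral_prod_expFactor_le hp ha (fun s d => θ * (P ^ (t - s)) k d) i t
  replace hm := hm.mono (hr.rewardSigma_le _) le_rfl
  set Z : Ω → ℝ := fun ω => expProcess P σ (mean (p i)) (fun s l j => r s l j ω)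
      (fun s l => a s l ω) i t k θ with hZ
  have h0 : ∀ ω, 0 ≤ Z ω := fun ω => (Real.exp_pos _).le
  have heq : ∀ ω, ENNReal.ofReal (Z ω) = ∏ s ∈ Finset.range t, ∏ d,
      expFactor (θ * (P ^ (t - s)) k d) σ (mean (p i)) (a (s + 1) d ω = i) (r (s + 1) d i ω) :=
    fun ω => ofReal_expProcess P σ (mean (p i)) (fun s l j => r s l j ω) (fun s l => a s l ω) i t k θ
  simp_rw [← heq] at hm hle
  have hZm : Measurable Z := by
    have h1 := hm.ennreal_toReal
    simp_rw [ENNReal.toReal_ofReal (h0 _)] at h1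
    exact h1
  constructor
  · refine ⟨hZm.aestronglyMeasurable, ?_⟩
    rw [hasFiniteIntegral_iff_ofReal (ae_of_all _ h0)]
    exact hle.trans_lt ENNReal.one_lt_top
  · rw [integral_eq_lintegral_of_nonneg_ae (ae_of_all _ h0) hZm.aestronglyMeasurable]
    exact ENNReal.toReal_le_of_le_ofReal zero_le_one (by simpa using hle)

end Noise

/-! ### Misleading indices and their expected number -/

section Regret

variable {M N : ℕ}

/-- The sum of exponential processes that dominates the indicator of a misleading index of arm `i`
or of the competing arm `b`, for agent `k` at time `t`. -/
noncomputable def deviationSum (P : Matrix (Fin M) (Fin M) ℝ) (σ γ η : ℝ) (f : ℝ → ℝ)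
    (m : Fin N → ℝ) (x : ℕ → Fin M → Fin N → ℝ) (a : ℕ → Fin M → Fin N) (i b : Fin N) (t : ℕ)
    (k : Fin M) : ℝ :=
  (t : ℝ) ^ (-γ) * ∑ l ∈ Finset.range (cellCount η t),
      expProcess P σ (m i) x a i t k (tilt M σ γ η (f t) t l) +
  (t : ℝ) ^ (-γ) * ∑ l ∈ Finset.range (cellCount η t),
      expProcess P σ (m b) x a b t k (-tilt M σ γ η (f t) t l)

theorem sum_expProcess_nonneg (P : Matrix (Fin M) (Fin M) ℝ) (σ γ η m : ℝ)
    (x : ℕ → Fin M → Fin N → ℝ) (a : ℕ → Fin M → Fin N) (i : Fin N) (t : ℕ)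
    (k : Fin M) (θ : ℕ → ℝ) :
    0 ≤ (t : ℝ) ^ (-γ) * ∑ l ∈ Finset.range (cellCount η t), expProcess P σ m x a i t k (θ l) :=
  mul_nonneg (by positivity) (Finset.sum_nonneg fun _ _ => (Real.exp_pos _).le)

theorem deviationSum_nonneg (P : Matrix (Fin M) (Fin M) ℝ) (σ γ η : ℝ) (f : ℝ → ℝ)
    (m : Fin N → ℝ) (x : ℕ → Fin M → Fin N → ℝ) (a : ℕ → Fin M → Fin N) (i b : Fin N) (t : ℕ)
    (k : Fin M) : 0 ≤ deviationSum P σ γ η f m x a i b t k :=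
  add_nonneg (sum_expProcess_nonneg ..) (sum_expProcess_nonneg ..)

/-- If the index of a sufficiently sampled suboptimal arm `i` is at least that of the better arm
`b`, then `deviationSum` is at least `1`. -/
theorem one_le_deviationSum [NeZero M] {P : Matrix (Fin M) (Fin M) ℝ} {σ γ η : ℝ} (hσ : 0 < σ) (hγ : 1 < γ)
    (hη0 : 0 < η) (hη4 : η < 4) {f : ℝ → ℝ} {m : Fin N → ℝ} {x : ℕ → Fin M → Fin N → ℝ}
    {a : ℕ → Fin M → Fin N} {i b : Fin N} {t : ℕ} {k : Fin M} (hf : 0 ≤ f t)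
    (h1 : ∀ j, 1 ≤ nHat P a j t k) (h2 : ∀ j, nHat P a j t k ≤ t)
    (hV : ∀ j, energy P a j t k ≤ (nHat P a j t k + f t) / M)
    (hQ : qIndex P σ γ η f x a t k b ≤ qIndex P σ γ η f x a t k i)
    (hC : 2 * (σ * Real.sqrt (2 * γ / gEta η * ((nHat P a i t k + f t) / (M * nHat P a i t k)) *
      (Real.log t / nHat P a i t k))) ≤ m b - m i) :
    1 ≤ deviationSum P σ γ η f m x a i b t k := by
  have hi0 : 0 < nHat P a i t k := zero_lt_one.trans_le (h1 i)
  have hb0 : 0 < nHat P a b t k := zero_lt_one.trans_le (h1 b)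
  have hmean : ∀ j, 0 < nHat P a j t k → sHat P x a j t k / nHat P a j t k =
      noise P (m j) x a j t k / nHat P a j t k + m j := by
    intro j hj
    rw [sHat_eq_noise_add P (m j)]
    field_simp
  unfold qIndex at hQ
  rw [hmean i hi0, hmean b hb0] at hQ
  set Ci := σ * Real.sqrt (2 * γ / gEta η * ((nHat P a i t k + f t) / (M * nHat P a i t k)) *
      (Real.log t / nHat P a i t k)) with hCi
  set Cb := σ * Real.sqrt (2 * γ / gEta η * ((nHat P a b t k + f t) / (M * nHat P a b t k)) *
      (Real.log t / nHat P a b t k)) with hCb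
  -- If the error of `i` is below `Ci`, its index is below `m i + 2 * Ci ≤ m b`; the index of `b` is
  -- no larger, so `b` is underestimated by more than `Cb`. The negated tilt handles this lower
  -- tail.
  rcases le_or_gt Ci (noise P (m i) x a i t k / nHat P a i t k) with h | h
  · have := one_le_sum_exp_tilt hσ hγ hη0 hη4 hf (h1 i) (h2 i) (hV i) h
    exact this.trans (le_add_of_nonneg_right (sum_expProcess_nonneg ..))
  · have h3 : Cb ≤ (-noise P (m b) x a b t k) / nHat P a b t k := by
      rw [neg_div]
      linarith
    have := one_le_sum_exp_tilt hσ hγ hη0 hη4 hf (h1 b) (h2 b) (hV b) h3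
    refine this.trans ?_
    refine le_trans (le_of_eq ?_) (le_add_of_nonneg_left (sum_expProcess_nonneg ..))
    congr 1
    refine Finset.sum_congr rfl fun l _ => ?_
    unfold expProcess
    congr 1
    ring

variable {Ω : Type*} [MeasurableSpace Ω] {μ : Measure Ω} [IsProbabilityMeasure μ]
  {p : Fin N → Measure ℝ} {σ : ℝ} {r : ℕ → Fin M → Fin N → Ω → ℝ}

/-- Each cell contributes mean at most `1`; the factor `2` counts the arms `i` and `b`. -/
theorem integral_deviationSum_le (hr : IsRewardProcess μ p r)
    (hp : ∀ i, IsSubGaussian (p i) σ) {a : ℕ → Fin M → Ω → Fin N}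
    (ha : ∀ t k, 1 ≤ t → Measurable[pastRewards r t] (a t k)) (P : Matrix (Fin M) (Fin M) ℝ)
    {γ η : ℝ} (hη0 : 0 < η) (f : ℝ → ℝ) (i b : Fin N) {t : ℕ} (ht : 1 ≤ t) (k : Fin M) :
    Integrable (fun ω => deviationSum P σ γ η f (fun j => mean (p j)) (fun s l j => r s l j ω)
      (fun s l => a s l ω) i b t k) μ ∧
    ∫ ω, deviationSum P σ γ η f (fun j => mean (p j)) (fun s l j => r s l j ω)
      (fun s l => a s l ω) i b t k ∂μ ≤
      2 * ((t : ℝ) ^ (-γ) * (Real.log t / Real.log (1 + η) + 1)) := by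
  have hone : ∀ (j : Fin N) (θ : ℕ → ℝ),
      Integrable (fun ω => (t : ℝ) ^ (-γ) * ∑ l ∈ Finset.range (cellCount η t),
        expProcess P σ (mean (p j)) (fun s l j => r s l j ω) (fun s l => a s l ω) j t k (θ l)) μ ∧
      ∫ ω, (t : ℝ) ^ (-γ) * ∑ l ∈ Finset.range (cellCount η t),
        expProcess P σ (mean (p j)) (fun s l j => r s l j ω) (fun s l => a s l ω) j t k (θ l) ∂μ ≤
      (t : ℝ) ^ (-γ) * (Real.log t / Real.log (1 + η) + 1) := by
    intro j θ
    have hint := fun l => hr.integral_expProcess_le hp ha P j t k (θ l)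
    refine ⟨(integrable_finsetSum _ fun l _ => (hint l).1).const_mul _, ?_⟩
    rw [integral_const_mul, integral_finsetSum _ fun l _ => (hint l).1]
    gcongr
    calc _ ≤ ∑ l ∈ Finset.range (cellCount η t), (1 : ℝ) :=
          Finset.sum_le_sum fun l _ => (hint l).2
      _ = cellCount η t := by simp
      _ ≤ _ := cellCount_le hη0 (by exact_mod_cast ht)
  obtain ⟨h1, h2⟩ := hone i fun l => tilt M σ γ η (f t) t l
  obtain ⟨h3, h4⟩ := hone b fun l => -tilt M σ γ η (f t) t l
  unfold deviationSum
  refine ⟨h1.add h3, ?_⟩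
  rw [integral_add h1 h3]
  linarith

end Regret

/-! ### Pathwise bound and comparison with the constant -/

section Final

variable {M N : ℕ}

/-- The pathwise bound on the total number of selections of a suboptimal arm. -/
theorem sum_selections_le [NeZero M] {G : SimpleGraph (Fin M)} [DecidableRel G.Adj] (hG : G.Connected)
    {κ : ℝ} (hκ0 : 0 < κ) (hκ1 : κ ≤ 1)
    {u : OrthonormalBasis (Fin M) ℝ (EuclideanSpace ℝ (Fin M))} {lam : Fin M → ℝ}
    (hu : IsOrderedEigenbasis (consensusMatrix G κ) u lam) (hlam : ∀ k, -1 < lam k)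
    {σ γ η : ℝ} (hσ : 0 < σ) (hγ : 1 < γ) (hη0 : 0 < η) (hη4 : η < 4)
    {t₀ : ℝ} (ht1 : t₀ ≤ 1) {f : ℝ → ℝ} (hf : MonotoneOn f (Set.Ici t₀)) (m : Fin N → ℝ)
    (x : ℕ → Fin M → Fin N → ℝ) (a : ℕ → Fin M → Fin N)
    (hinit : ∀ t k, 1 ≤ t → t ≤ N → (a t k : ℕ) + 1 = t)
    (hmax : ∀ t k, N ≤ t → ∀ j, qIndex (consensusMatrix G κ) σ γ η f x a t k j ≤
      qIndex (consensusMatrix G κ) σ γ η f x a t k (a (t + 1) k))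
    {i b : Fin N} (hgap : 0 < m b - m i) (T : ℕ) :
    ∑ s ∈ Finset.range T, ∑ d, (if a (s + 1) d = i then (1 : ℝ) else 0) ≤
      4 * σ ^ 2 * γ * Real.log T / ((m b - m i) ^ 2 * gEta η) *
          (1 + Real.sqrt (1 + (m b - m i) ^ 2 * M * gEta η / (2 * γ * σ ^ 2) *
            (f T / Real.log T))) + M * epsN lam + M +
      ∑ t ∈ Finset.Ico 2 T, ∑ k, ((if f t < epsC u lam k then 1 else 0) +
        deviationSum (consensusMatrix G κ) σ γ η f m x a i b t k) := by
  set P := consensusMatrix G κ with hP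
  have hM : (0 : ℝ) < M := Nat.cast_pos.2 (NeZero.pos M)
  have hg := gEta_pos hη0 hη4
  have hP0 : ∀ k d, 0 ≤ P k d := consensusMatrix_nonneg G hκ0 hκ1
  have hP1 : P *ᵥ (fun _ => 1) = fun _ => 1 := consensusMatrix_mulVec_one G κ
  have hεn : 0 ≤ epsN lam := epsN_nonneg fun q hq => hu.abs_lam_lt_one hG hκ0 hlam hq
  have hεc : ∀ k, 0 ≤ epsC u lam k := epsC_nonneg fun q j hj =>
    hu.abs_lam_mul_lt_one hG hκ0 hlam q hj
  have hξ0 : ∀ s d, (0 : ℝ) ≤ if a (s + 1) d = i then 1 else 0 := fun s d => by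
    split_ifs <;> norm_num
  have hξ1 : ∀ s d, (if a (s + 1) d = i then (1 : ℝ) else 0) ≤ 1 := fun s d => by
    split_ifs <;> norm_num
  have hT0 : 0 ≤ Real.log T := Real.log_natCast_nonneg T
  have hγ0 : 0 < γ := by linarith
  set A₀ := 4 * σ ^ 2 * γ * Real.log T / ((m b - m i) ^ 2 * gEta η) *
          (1 + Real.sqrt (1 + (m b - m i) ^ 2 * M * gEta η / (2 * γ * σ ^ 2) *
            (f T / Real.log T))) with hA₀
  have hA₀0 : 0 ≤ A₀ := by positivity
  refine le_add_sum_of_step (y := fun n => ∑ s ∈ Finset.range n, ∑ d,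
      (if a (s + 1) d = i then (1 : ℝ) else 0))
    (b := fun t => ∑ k, ((if f t < epsC u lam k then 1 else 0) +
      deviationSum P σ γ η f m x a i b t k))
    (by positivity) hM.le (by simp) (fun n => ?_) T (fun n _ => ?_) (fun n hn hAn => ?_)
  · refine Finset.sum_nonneg fun k _ => add_nonneg ?_ (deviationSum_nonneg ..)
    split_ifs <;> norm_num
  · rw [Finset.sum_range_succ]
    gcongr
    calc _ ≤ ∑ _d : Fin M, (1 : ℝ) := Finset.sum_le_sum fun d _ => hξ1 n d
      _ = M := by simp
  · have hib : i ≠ b := by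
      rintro rfl
      simp at hgap
    have hiN := i.isLt
    have hbN := b.isLt
    have hne : (i : ℕ) ≠ b := fun h => hib (Fin.ext h)
    have hAn0 : 0 < ∑ s ∈ Finset.range n, ∑ d, (if a (s + 1) d = i then (1 : ℝ) else 0) :=
      lt_of_le_of_lt (by positivity) hAn
    -- A positive count means that the initial sampling of `i`, at time `i + 1`, is past; until time
    -- `N` it is not selected again.
    have hin : (i : ℕ) < n := by
      by_contra! hni
      refine hAn0.ne' (Finset.sum_eq_zero fun s hs => Finset.sum_eq_zero fun d _ => if_neg ?_)
      intro h
      have h1 := Finset.mem_range.1 hs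
      have h2 := hinit (s + 1) d (by omega) (by omega)
      rw [h] at h2
      omega
    have hearly : n < N → ∀ d, a (n + 1) d ≠ i := by
      intro hnN d h
      have h2 := hinit (n + 1) d (by omega) (by omega)
      rw [h] at h2
      omega
    simp only [Finset.sum_range_succ]
    rcases lt_or_ge n N with hnN | hnN
    · left
      rw [Finset.sum_eq_zero (f := fun d => if a (n + 1) d = i then (1 : ℝ) else 0)
        fun d _ => if_neg (hearly hnN d), add_zero]
    right
    -- Two distinct arms force `N ≥ 2`; thus `Real.log n` and `Real.log T` are positive below.
    have hn2 : 2 ≤ n := by omega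
    refine ⟨hn2, ?_⟩
    gcongr with k
    have hdev := deviationSum_nonneg P σ γ η f m x a i b n k
    by_cases hfk : f n < epsC u lam k
    · rw [if_pos hfk]
      linarith [hξ1 n k]
    rw [if_neg hfk, zero_add]
    by_cases hsel : a (n + 1) k = i
    swap
    · rw [if_neg hsel]; exact hdev
    rw [if_pos hsel]
    have hfk' : epsC u lam k ≤ f n := not_lt.1 hfk
    have hfn : 0 ≤ f n := (hεc k).trans hfk'
    have hone : ∀ j, 1 ≤ nHat P a j n k := by
      intro j
      have hj := j.isLt
      refine one_le_nHat hP0 hP1 a j (s := j) (by omega) (fun d => Fin.ext ?_) k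
      have := hinit (j + 1) d (by omega) (by omega)
      omega
    refine one_le_deviationSum hσ hγ hη0 hη4 hfn hone (fun j => nHat_le hP0 hP1 a j n k)
      (fun j => ?_) (hsel ▸ hmax n k hnN b) ?_
    · have h1 := sum_sq_consensus_le hu hG hκ0 hlam
        (ξ := fun s d => if a (s + 1) d = j then 1 else 0)
        (fun s d => by split_ifs <;> norm_num) (fun s d => by split_ifs <;> norm_num) n k
      rw [← hP, ← nHat_eq] at h1
      refine h1.trans ?_
      gcongr
    · have hn1 : (1 : ℝ) < n := by exact_mod_cast hn2
      have hnT : (n : ℝ) ≤ T := by exact_mod_cast hn.le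
      refine two_mul_radius_le (F := f T) (L := Real.log T) hσ hγ hg hgap hfn
        (hf (ht1.trans hn1.le) ((ht1.trans hn1.le).trans hnT) hnT) (Real.log_pos hn1)
        (Real.log_le_log (by linarith) hnT) (zero_lt_one.trans_le (hone i)) ?_
      -- The network total exceeds `A₀ + M * epsN lam`, so passing to the agent's own estimate still
      -- leaves `A₀ ≤ M * nHat`.
      rw [← hA₀]
      have h1 := abs_consensus_sub_average_le hu hG hκ0 hlam
        (ξ := fun s d => if a (s + 1) d = i then 1 else 0)
        (fun s d => by split_ifs <;> simp) n k
      rw [← hP, ← nHat_eq] at h1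
      have h2 := (abs_le.1 h1).1
      have h3 : (∑ s ∈ Finset.range n, ∑ d, (if a (s + 1) d = i then (1 : ℝ) else 0)) / M ≤
          nHat P a i n k + epsN lam := by linarith
      rw [div_le_iff₀ hM] at h3
      linarith

/-- The numerical comparison of the summed tail bounds with the constant `L`. -/
theorem sum_tail_add_le_constL {γ η t₀ : ℝ} (hγ : 1 < γ) (hη0 : 0 < η) (f : ℝ → ℝ) {εn : ℝ}
    (hεn : 0 ≤ εn) (εc : Fin M → ℝ) (T : ℕ) :
    M * εn + M + ∑ t ∈ Finset.Ico 2 T, ∑ _k : Fin M,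
        2 * ((t : ℝ) ^ (-γ) * (Real.log t / Real.log (1 + η) + 1)) +
      ∑ k, tDagger t₀ f (εc k) ≤ constL M γ η t₀ f εn εc := by
  have hl : 0 < Real.log (1 + η) := Real.log_pos (by linarith)
  have hg : 0 < γ - 1 := by linarith
  have hM : (0 : ℝ) ≤ M := Nat.cast_nonneg M
  have h1 := sum_rpow_neg_le hγ T
  have h2 := sum_log_mul_rpow_neg_le hγ T
  have h3 : ∑ t ∈ Finset.Ico 2 T, ∑ _k : Fin M,
      2 * ((t : ℝ) ^ (-γ) * (Real.log t / Real.log (1 + η) + 1)) =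
      2 * M * ((∑ t ∈ Finset.Ico 2 T, Real.log t * (t : ℝ) ^ (-γ)) / Real.log (1 + η) +
        ∑ t ∈ Finset.Ico 2 T, (t : ℝ) ^ (-γ)) := by
    rw [Finset.sum_div, ← Finset.sum_add_distrib, Finset.mul_sum]
    refine Finset.sum_congr rfl fun t _ => ?_
    simp only [Finset.sum_const, Finset.card_univ, Fintype.card_fin, nsmul_eq_mul]
    ring
  have h4 : Real.log (1 + η) ≤ Real.log ((1 + εn) * (1 + η)) :=
    Real.log_le_log (by linarith) (by nlinarith)
  -- Since `γ / (γ - 1) = 1 + 1 / (γ - 1)`, the constant has room for an extra `2 * M`, which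
  -- absorbs the overshoot `M` of the threshold.
  have h5 : 2 * M * ((1 / (γ - 1) ^ 2 + 1) / Real.log (1 + η) + 1 / (γ - 1)) + 2 * M ≤
      2 * M / Real.log (1 + η) *
      (1 / (γ - 1) ^ 2 + γ * Real.log ((1 + εn) * (1 + η)) / (γ - 1) + 1) := by
    calc _ = 2 * M / Real.log (1 + η) *
        (1 / (γ - 1) ^ 2 + γ * Real.log (1 + η) / (γ - 1) + 1) := by field_simp; ring
      _ ≤ _ := by gcongr
  have h6 : 2 * M * ((∑ t ∈ Finset.Ico 2 T, Real.log t * (t : ℝ) ^ (-γ)) / Real.log (1 + η) +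
        ∑ t ∈ Finset.Ico 2 T, (t : ℝ) ^ (-γ)) ≤
      2 * M * ((1 / (γ - 1) ^ 2 + 1) / Real.log (1 + η) + 1 / (γ - 1)) := by gcongr
  rw [h3, constL, Finset.sum_sub_distrib]
  simp only [Finset.sum_const, Finset.card_univ, Fintype.card_fin, nsmul_eq_mul, mul_one]
  linarith

end Final

end CoopUCB

/-! ### The main theorem: integrating the pathwise bound -/

theorem theorem2 {M N : ℕ} [NeZero M]
    -- communication graph and consensus matrix
    (G : SimpleGraph (Fin M)) [DecidableRel G.Adj] (hG : G.Connected)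
    (κ : ℝ) (hκ0 : 0 < κ) (hκ1 : κ ≤ 1)
    (u : OrthonormalBasis (Fin M) ℝ (EuclideanSpace ℝ (Fin M))) (lam : Fin M → ℝ)
    (hu : CoopUCB.IsOrderedEigenbasis (CoopUCB.consensusMatrix G κ) u lam)
    (hlam : ∀ k, -1 < lam k)
    -- sub-Gaussian rewards
    {Ω : Type*} [MeasurableSpace Ω] (μ : MeasureTheory.Measure Ω)
    [MeasureTheory.IsProbabilityMeasure μ]
    (p : Fin N → MeasureTheory.Measure ℝ) (σ : ℝ) (hσ : 0 < σ)
    (hp : ∀ i, CoopUCB.IsSubGaussian (p i) σ)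
    (r : ℕ → Fin M → Fin N → Ω → ℝ) (hr : CoopUCB.IsRewardProcess μ p r)
    -- parameters of the algorithm
    (γ : ℝ) (hγ : 1 < γ) (η : ℝ) (hη0 : 0 < η) (hη4 : η < 4)
    (t₀ : ℝ) (ht0 : 0 ≤ t₀) (ht1 : t₀ ≤ 1) (f : ℝ → ℝ) (hf : MonotoneOn f (Set.Ici t₀))
    (hflog : f =o[Filter.atTop] Real.log)
    (hfε : ∀ k, ∃ t, t₀ ≤ t ∧ CoopUCB.epsC u lam k ≤ f t)
    -- the selections made by the algorithm
    (a : ℕ → Fin M → Ω → Fin N)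
    (ha : CoopUCB.IsCoopUCB2 (CoopUCB.consensusMatrix G κ) σ γ η f r a)
    -- a suboptimal arm and a time horizon
    (i : Fin N) (hi : 0 < CoopUCB.gap p i) (T : ℕ) (hT : 1 ≤ T) :
    ∑ k, ∫ ω, (CoopUCB.numSelections a i k T ω : ℝ) ∂μ ≤
      4 * σ ^ 2 * γ * Real.log T / (CoopUCB.gap p i ^ 2 * CoopUCB.gEta η) *
          (1 + Real.sqrt (1 + CoopUCB.gap p i ^ 2 * M * CoopUCB.gEta η / (2 * γ * σ ^ 2) *
            (f T / Real.log T))) +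
        CoopUCB.constL M γ η t₀ f (CoopUCB.epsN lam) (CoopUCB.epsC u lam) := by
  have : Nonempty (Fin N) := ⟨i⟩
  obtain ⟨b, hb⟩ := exists_eq_ciSup_of_finite (f := fun j => CoopUCB.mean (p j))
  have hgap : CoopUCB.gap p i = CoopUCB.mean (p b) - CoopUCB.mean (p i) := by
    rw [CoopUCB.gap, ← hb]
  rw [hgap] at hi ⊢
  have hmeas : ∀ t k, 1 ≤ t → Measurable (a t k) := fun t k ht =>
    (ha.predictable t k ht).mono ((CoopUCB.pastRewards_le r t).trans (hr.rewardSigma_le _)) le_rfl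
  have hnum : ∀ k ω, (CoopUCB.numSelections a i k T ω : ℝ) =
      ∑ s ∈ Finset.range T, if a (s + 1) k ω = i then (1 : ℝ) else 0 := by
    intro k ω
    rw [CoopUCB.numSelections, Finset.card_filter, Finset.range_eq_Ico,
      Finset.sum_Ico_add' (fun s => if a s k ω = i then (1 : ℝ) else 0) 0 T 1]
    push_cast
    rfl
  have hsel : ∀ s k, Integrable (fun ω => if a (s + 1) k ω = i then (1 : ℝ) else 0) μ := by
    intro s k
    refine Integrable.of_bound (Measurable.ite (hmeas (s + 1) k (by omega)
      (measurableSet_singleton i)) measurable_const measurable_const).aestronglyMeasurable 1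
      (ae_of_all _ fun ω => ?_)
    split_ifs <;> simp
  have hnumint : ∀ k, Integrable (fun ω => (CoopUCB.numSelections a i k T ω : ℝ)) μ := by
    intro k
    simp_rw [hnum]
    exact integrable_finsetSum _ fun s _ => hsel s k
  set D : ℕ → Fin M → Ω → ℝ := fun t k ω =>
    CoopUCB.deviationSum (CoopUCB.consensusMatrix G κ) σ γ η f (fun j => CoopUCB.mean (p j))
      (fun s l j => r s l j ω) (fun s l => a s l ω) i b t k with hD
  have hDint : ∀ t ∈ Finset.Ico 2 T, ∀ k, Integrable (D t k) μ ∧ ∫ ω, D t k ω ∂μ ≤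
      2 * ((t : ℝ) ^ (-γ) * (Real.log t / Real.log (1 + η) + 1)) := fun t ht k =>
    CoopUCB.integral_deviationSum_le hr hp ha.predictable _ hη0 f i b
      (by have := (Finset.mem_Ico.1 ht).1; omega) k
  have hcard : ∑ t ∈ Finset.Ico 2 T, ∑ k, (if f t < CoopUCB.epsC u lam k then (1 : ℝ) else 0) ≤
      ∑ k, CoopUCB.tDagger t₀ f (CoopUCB.epsC u lam k) := by
    rw [Finset.sum_comm]
    refine Finset.sum_le_sum fun k _ => ?_
    rw [Finset.sum_boole]
    exact CoopUCB.card_lt_le_tDagger ht0 hf (hfε k) T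
  -- For `T = 1` the factor `Real.log T` is `0`, so `A` vanishes whatever the quotient by zero under
  -- the root.
  set A : ℝ := 4 * σ ^ 2 * γ * Real.log T /
      ((CoopUCB.mean (p b) - CoopUCB.mean (p i)) ^ 2 * CoopUCB.gEta η) *
    (1 + Real.sqrt (1 + (CoopUCB.mean (p b) - CoopUCB.mean (p i)) ^ 2 * M * CoopUCB.gEta η /
      (2 * γ * σ ^ 2) * (f T / Real.log T))) with hA
  have hpath : ∀ ω, ∑ k, (CoopUCB.numSelections a i k T ω : ℝ) ≤
      (A + M * CoopUCB.epsN lam + M +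
        ∑ t ∈ Finset.Ico 2 T, ∑ k, (if f t < CoopUCB.epsC u lam k then (1 : ℝ) else 0)) +
      ∑ t ∈ Finset.Ico 2 T, ∑ k, D t k ω := by
    intro ω
    have h := CoopUCB.sum_selections_le hG hκ0 hκ1 hu hlam hσ hγ hη0 hη4 ht1 hf
      (fun j => CoopUCB.mean (p j)) (fun s l j => r s l j ω) (fun s l => a s l ω)
      (fun t k h1 h2 => ha.init t k ω h1 h2) (fun t k h j => ha.argmax t k ω h j) hi T
    simp_rw [hnum]
    rw [Finset.sum_comm]
    refine h.trans (le_of_eq ?_)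
    simp_rw [Finset.sum_add_distrib]
    rw [← add_assoc]
  have hDsum : ∀ t ∈ Finset.Ico 2 T, Integrable (fun ω => ∑ k, D t k ω) μ := fun t ht =>
    integrable_finsetSum _ fun k _ => (hDint t ht k).1
  rw [← integral_finsetSum _ fun k _ => hnumint k]
  have hint := integral_mono (integrable_finsetSum _ fun k _ => hnumint k)
    ((integrable_const _).add (integrable_finsetSum _ hDsum)) hpath
  simp only [Pi.add_apply] at hint
  rw [integral_add (integrable_const _) (integrable_finsetSum _ hDsum), integral_const,
    probReal_univ, one_smul, integral_finsetSum _ hDsum] at hint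
  have htail : ∑ t ∈ Finset.Ico 2 T, ∫ ω, ∑ k, D t k ω ∂μ ≤ ∑ t ∈ Finset.Ico 2 T, ∑ _k : Fin M,
      2 * ((t : ℝ) ^ (-γ) * (Real.log t / Real.log (1 + η) + 1)) := by
    refine Finset.sum_le_sum fun t ht => ?_
    rw [integral_finsetSum _ fun k _ => (hDint t ht k).1]
    exact Finset.sum_le_sum fun k _ => (hDint t ht k).2
  have hL := CoopUCB.sum_tail_add_le_constL (t₀ := t₀) hγ hη0 f
    (CoopUCB.epsN_nonneg fun q hq => hu.abs_lam_lt_one hG hκ0 hlam hq) (CoopUCB.epsC u lam) T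
  linarith
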